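/- Let $\mathcal F$ be the complex Fock space of a pair of fermionic fields $b(z)=\sum_{n\in\mathbb Z} b(n)z^{-n}$, $c(z)=\sum_{n\in\mathbb Z} c(n)z^{-n-1}$ with $[b(m),c(n)]_+=\delta_{m,-n}$, $[b(m),b(n)]_+=[c(m),c(n)]_+=0$, generated by a vacuum vector annihilated by $b(n+1)$ and $c(n)$ for $n\ge 0$. For fields $A(z)=\sum_n A_n z^{-n-1}$ and $B(z)=\sum_n B_n z^{-n-1}$, the normally ordered product is $:A(z)B(z):\,=\sum_n\Bigl(\sum_{i<0}A_iB_{n-i-1}+\varepsilon\sum_{i\ge0}B_{n-i-1}A_i\Bigr)z^{-n-1}$, with $\varepsilon=-1$ if $A$ and $B$ are both fermionic and $\varepsilon=1$ otherwise; write $:A^2:\,=\,:AA:$, $:A^3:\,=\,:A(:AA:):$. Put $$j(z)=\,:b(z)c(z):\,=\sum_{n} j_n z^{-n-1},\qquad T(z)=\,:\partial b(z)\,c(z):,\qquad \widetilde W(z)=\tfrac12\bigl(:\partial^2 b(z)\,c(z):-:\partial b(z)\,\partial c(z):\bigr).$$ Let $\mathcal F^l\subset\mathcal F$ $(l\in\mathbb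 Z)$ be the eigenspace of $j_0$ with eigenvalue $l$. For $\alpha\in\mathbb C$ let $\mathcal H_\alpha$ be the Fock space of the Heisenberg algebra $[j_m,j_n]=m\delta_{m,-n}$ with vacuum vector $|\alpha\rangle$, $j_n|\alpha\rangle=\alpha\delta_{n,0}|\alpha\rangle$ for $n\ge0$, and again write $j(z)=\sum_n j_nz^{-n-1}$ for the free bosonic field on $\mathcal H_\alpha$. Then, as fields on $\mathcal F$, $$T(z)=\tfrac12\bigl(:j(z)^2:+\partial j(z)\bigr),\qquad \widetilde W(z)=\tfrac1{12}\bigl(4:j(z)^3:+6:j(z)\,\partial j(z):+\partial^2 j(z)\bigr).$$ Moreover, for every $l\in\mathbb Z$ there is a linear isomorphism $\Phi:\mathcal H_l\to\mathcal F^l$ which intertwines the operators $j_n$, $n\in\mathbb Z$ (the boson–fermion correspondence), and under every such $\Phi$ the fields $T(z)$ and $\widetilde W(z)$ on $\mathcal F^l$ correspond to the fields $\tfrac12(:j(z)^2:+\partial j(z))$ and $\tfrac1{12}(4:j(z)^3:+6:j(z)\,\partial j(z):+\partial^2 j(z))$ on $\mathcal H_l$. -/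

import Mathlib

noncomputable section

namespace BosonFermion

open VertexOperator

/-! ## Fields

A field `A(z) = ∑ₙ Aₙ z^{-n-1}` on a complex vector space `V` is a `VertexOperator ℂ V`;
its modes `Aₙ` are `VertexOperator.ncoeff A n`. -/

section Fields

variable {V : Type*} [AddCommGroup V] [Module ℂ V]

/-- The field `∑ₙ a n z^{-n-1}` with prescribed modes `a n`, where for every vector `v` one has
`a n v = 0` for `n` large. -/
def ofModes (a : ℤ → Module.End ℂ V) (h : ∀ v, ∃ N : ℤ, ∀ n ≥ N, a n v = 0) :
    VertexOperator ℂ V :=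
  VertexOperator.of_coeff (fun n => a (-n - 1)) (fun v => by
    obtain ⟨N, hN⟩ := h v
    refine ⟨-N, fun n hn => ?_⟩
    by_contra hlt
    exact hn (hN _ (by lia)))

@[simp]
theorem ncoeff_ofModes (a : ℤ → Module.End ℂ V) (h : ∀ v, ∃ N : ℤ, ∀ n ≥ N, a n v = 0) (n : ℤ) :
    ncoeff (ofModes a h) n = a n := by
  rw [ofModes, ncoeff_of_coeff]
  congr 1
  ring

/-- The modes of a field annihilate a given vector from some index on. -/
theorem exists_ncoeff_eq_zero (A : VertexOperator ℂ V) (v : V) :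
    ∃ N : ℤ, ∀ n ≥ N, ncoeff A n v = 0 := by
  refine ⟨-((HahnModule.of ℂ).symm (A v)).order, fun n hn => ?_⟩
  exact ncoeff_eq_zero_of_lt_order A n v (by lia)

/-- The derivative `∂A(z)` of a field; its modes are `(∂A)ₙ = -n Aₙ₋₁`. -/
def fieldDeriv (A : VertexOperator ℂ V) : VertexOperator ℂ V :=
  ofModes (fun n => (-n : ℂ) • ncoeff A (n - 1)) (fun v => by
    obtain ⟨N, hN⟩ := exists_ncoeff_eq_zero A v
    exact ⟨N + 1, fun n hn => by simp [hN (n - 1) (by lia)]⟩)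

theorem finite_support_left (A B : VertexOperator ℂ V) (n : ℤ) (v : V) :
    (Function.support fun k : ℕ =>
      ncoeff A (-(k : ℤ) - 1) (ncoeff B (n + k) v)).Finite := by
  obtain ⟨N, hN⟩ := exists_ncoeff_eq_zero B v
  refine (Set.finite_lt_nat (N - n).toNat).subset fun k hk => ?_
  by_contra hlt
  have : N ≤ n + k := by simp only [Set.mem_ofPred_eq] at hlt; lia
  exact hk (by simp [hN _ this])

theorem finite_support_right (A B : VertexOperator ℂ V) (n : ℤ) (v : V) :
    (Function.support fun k : ℕ =>
      ncoeff B (n - k - 1) (ncoeff A k v)).Finite := by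
  obtain ⟨N, hN⟩ := exists_ncoeff_eq_zero A v
  refine (Set.finite_lt_nat N.toNat).subset fun k hk => ?_
  by_contra hlt
  have : N ≤ k := by simp only [Set.mem_ofPred_eq] at hlt; lia
  exact hk (by simp [hN _ this])

/-- The `n`-th mode of the normally ordered product of `A` and `B`,
`∑_{i < 0} Aᵢ Bₙ₋ᵢ₋₁ + ε ∑_{i ≥ 0} Bₙ₋ᵢ₋₁ Aᵢ`, where `ε` is `-1` if both fields are odd and `1`
otherwise. The sums (with `i = -k - 1`, resp. `i = k`) are finite on every vector. -/
def normalMode (ε : ℤˣ) (A B : VertexOperator ℂ V) (n : ℤ) : Module.End ℂ V where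
  toFun v :=
    (∑ᶠ k : ℕ, ncoeff A (-(k : ℤ) - 1) (ncoeff B (n + k) v)) +
      ((ε : ℤ) : ℂ) • ∑ᶠ k : ℕ, ncoeff B (n - k - 1) (ncoeff A k v)
  map_add' u v := by
    simp only [map_add]
    rw [finsum_add_distrib (finite_support_left A B n u) (finite_support_left A B n v),
      finsum_add_distrib (finite_support_right A B n u) (finite_support_right A B n v), smul_add]
    abel
  map_smul' r v := by
    simp only [map_smul, RingHom.id_apply]
    rw [← smul_finsum, ← smul_finsum, smul_add, smul_comm r]

/-- The normally ordered product `:A(z)B(z):`, with the sign `ε` of the exchange of `A` and `B`. -/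
def normalOrder (ε : ℤˣ) (A B : VertexOperator ℂ V) : VertexOperator ℂ V :=
  ofModes (normalMode ε A B) (fun v => by
    obtain ⟨N, hN⟩ := exists_ncoeff_eq_zero A v
    obtain ⟨M, hM⟩ := exists_ncoeff_eq_zero B v
    choose P hP using fun k : ℕ => exists_ncoeff_eq_zero B (ncoeff A k v)
    obtain ⟨Q, hQ⟩ := ((Finset.range N.toNat).image P).bddAbove
    refine ⟨max M (Q + N.toNat + 1), fun n hn => ?_⟩
    have h1 : ∀ k : ℕ, ncoeff A (-(k : ℤ) - 1) (ncoeff B (n + k) v) = 0 := fun k => by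
      rw [hM _ (by have := le_max_left M (Q + N.toNat + 1); lia), map_zero]
    have h2 : ∀ k : ℕ, ncoeff B (n - k - 1) (ncoeff A k v) = 0 := fun k => by
      by_cases hk : k < N.toNat
      · have hQk : P k ≤ Q := hQ (by simpa using ⟨k, by lia, rfl⟩)
        exact hP k _ (by have := le_max_right M (Q + N.toNat + 1); lia)
      · rw [hN k (by lia), map_zero]
    simp [normalMode, h1, h2])

/-- Normally ordered product of two even (bosonic) fields. -/
abbrev nopEven (A B : VertexOperator ℂ V) : VertexOperator ℂ V := normalOrder 1 A B

/-- Normally ordered product of two odd (fermionic) fields. -/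
abbrev nopOdd (A B : VertexOperator ℂ V) : VertexOperator ℂ V := normalOrder (-1) A B

end Fields

/-! ## The Fock space of the `bc` fields

`Fock` is the exterior algebra on anticommuting generators indexed by `ℕ ⊕ ℕ`: the generator
`inl k` stands for the creation operator `b(-k)`, the generator `inr k` for `c(-k-1)`, and the
vacuum is `1`. Creation operators act by left multiplication and annihilation operators by
contraction. -/

/-- The fermionic Fock space `𝓕`. -/
abbrev Fock : Type := ExteriorAlgebra ℂ ((ℕ ⊕ ℕ) →₀ ℂ)

/-- Left multiplication by the `i`-th generator. -/
def create (i : ℕ ⊕ ℕ) : Module.End ℂ Fock :=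
  LinearMap.mulLeft ℂ (ExteriorAlgebra.ι ℂ (Finsupp.single i 1))

/-- The odd derivation dual to the `i`-th generator. -/
def annihilate (i : ℕ ⊕ ℕ) : Module.End ℂ Fock :=
  CliffordAlgebra.contractLeft (Q := (0 : QuadraticForm ℂ ((ℕ ⊕ ℕ) →₀ ℂ))) (Finsupp.lapply i)

theorem finite_annihilate_ne_zero (v : Fock) : {i | annihilate i v ≠ 0}.Finite := by
  induction v using CliffordAlgebra.left_induction with
  | algebraMap r =>
    refine Set.finite_empty.subset fun i hi => hi ?_
    exact CliffordAlgebra.contractLeft_algebraMap _ _ _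
  | add x y hx hy =>
    refine (hx.union hy).subset fun i hi => ?_
    by_contra h
    simp only [Set.mem_union, Set.mem_ofPred_eq, not_or, not_not] at h
    exact hi (by rw [map_add, h.1, h.2, add_zero])
  | ι_mul x m hx =>
    refine (hx.union m.support.finite_toSet).subset fun i hi => ?_
    by_contra h
    simp only [Set.mem_union, Set.mem_ofPred_eq, not_or, not_not, Finset.mem_coe,
      Finsupp.mem_support_iff] at h
    refine hi ((CliffordAlgebra.contractLeft_ι_mul _ _ _).trans ?_)
    have h1 := h.1
    rw [annihilate] at h1
    rw [h1]
    simp [h.2]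

/-- The operators `b(n)`: creation operators for `n ≤ 0`, annihilation operators for `n ≥ 1`. -/
def bMode : ℤ → Module.End ℂ Fock
  | Int.ofNat 0 => create (Sum.inl 0)
  | Int.ofNat (k + 1) => annihilate (Sum.inr k)
  | Int.negSucc k => create (Sum.inl (k + 1))

/-- The operators `c(n)`: creation operators for `n < 0`, annihilation operators for `n ≥ 0`. -/
def cMode : ℤ → Module.End ℂ Fock
  | Int.ofNat k => annihilate (Sum.inl k)
  | Int.negSucc k => create (Sum.inr k)

theorem exists_bMode_eq_zero (v : Fock) : ∃ N : ℤ, ∀ n ≥ N, bMode (n + 1) v = 0 := by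
  obtain ⟨N, hN⟩ := ((finite_annihilate_ne_zero v).preimage
    (Sum.inr_injective (α := ℕ) (β := ℕ)).injOn).bddAbove
  refine ⟨N + 1, fun n hn => ?_⟩
  obtain ⟨k, rfl⟩ := Int.eq_ofNat_of_zero_le (show 0 ≤ n by lia)
  by_contra h
  have : k ≤ N := hN h
  lia

theorem exists_cMode_eq_zero (v : Fock) : ∃ N : ℤ, ∀ n ≥ N, cMode n v = 0 := by
  obtain ⟨N, hN⟩ := ((finite_annihilate_ne_zero v).preimage
    (Sum.inl_injective (α := ℕ) (β := ℕ)).injOn).bddAbove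
  refine ⟨N + 1, fun n hn => ?_⟩
  obtain ⟨k, rfl⟩ := Int.eq_ofNat_of_zero_le (show 0 ≤ n by lia)
  by_contra h
  have : k ≤ N := hN h
  lia

/-- The field `b(z) = ∑ₙ b(n) z^{-n}`; the coefficient of `z^{-n-1}` is `b(n+1)`. -/
def b : VertexOperator ℂ Fock := ofModes (fun n => bMode (n + 1)) exists_bMode_eq_zero

/-- The field `c(z) = ∑ₙ c(n) z^{-n-1}`. -/
def c : VertexOperator ℂ Fock := ofModes cMode exists_cMode_eq_zero

/-- `j(z) = :b(z)c(z):`, with modes `jₙ`. -/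
def j : VertexOperator ℂ Fock := nopOdd b c

/-- `T(z) = :∂b(z)c(z):`. -/
def T : VertexOperator ℂ Fock := nopOdd (fieldDeriv b) c

/-- `W̃(z) = ½(:∂²b(z)c(z): - :∂b(z)∂c(z):)`. -/
def Wtilde : VertexOperator ℂ Fock :=
  (1 / 2 : ℂ) • (nopOdd (fieldDeriv (fieldDeriv b)) c - nopOdd (fieldDeriv b) (fieldDeriv c))

/-- The charge `l` subspace `𝓕ˡ` of `𝓕`: the `l`-eigenspace of `j₀`. -/
def charge (l : ℤ) : Submodule ℂ Fock := Module.End.eigenspace (ncoeff j 0) (l : ℂ)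

/-! ## The Fock spaces of the Heisenberg algebra -/

/-- The underlying space of the Heisenberg Fock space `𝓗_α`: polynomials in the creation operators
`j₋₁, j₋₂, …`, the variable `k` being `j₋ₖ₋₁`; the vacuum vector is `1`. -/
abbrev Heis : Type := MvPolynomial ℕ ℂ

/-- The Heisenberg operators on `𝓗_α`: `j₀ = α`, `jₙ = n ∂/∂j₋ₙ` for `n > 0`, and `jₙ` is
multiplication by the corresponding variable for `n < 0`. -/
def heisMode (α : ℂ) : ℤ → Module.End ℂ Heis
  | Int.ofNat 0 => α • LinearMap.id
  | Int.ofNat (k + 1) => (k + 1 : ℂ) • (MvPolynomial.pderiv k).toLinearMap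
  | Int.negSucc k => LinearMap.mulLeft ℂ (MvPolynomial.X k)

theorem exists_heisMode_eq_zero (α : ℂ) (p : Heis) : ∃ N : ℤ, ∀ n ≥ N, heisMode α n p = 0 := by
  obtain ⟨N, hN⟩ := p.vars.bddAbove
  refine ⟨N + 2, fun n hn => ?_⟩
  obtain ⟨k, rfl⟩ : ∃ k : ℕ, n = Int.ofNat (k + 1) := ⟨(n - 1).toNat, by
    simp only [Int.ofNat_eq_natCast]; lia⟩
  have hk : k ∉ p.vars := fun h => by
    have : k ≤ N := hN h
    simp only [Int.ofNat_eq_natCast] at hn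
    lia
  simp [heisMode, MvPolynomial.pderiv_eq_zero_of_notMem_vars hk]

/-- The free bosonic field `j(z) = ∑ₙ jₙ z^{-n-1}` on `𝓗_α`. -/
def jH (α : ℂ) : VertexOperator ℂ Heis := ofModes (heisMode α) (exists_heisMode_eq_zero α)

/-- A linear isomorphism `𝓗_l ≅ 𝓕ˡ` is a boson-fermion correspondence (in charge `l`) if it is an
isomorphism of representations of the Heisenberg algebra, i.e. intertwines all modes `jₙ`. -/
def IsBosonFermionCorrespondence (l : ℤ) (Φ : Heis ≃ₗ[ℂ] charge l) : Prop :=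
  ∀ (n : ℤ) (x : Heis), (Φ (ncoeff (jH l) n x) : Fock) = ncoeff j n (Φ x : Fock)

end BosonFermion

end

/-!
The current `J = :βγ:` of a pair of fermionic fields generates a Heisenberg algebra, and
`:Jβ: = ∂β`, `:Jγ: = -∂γ`. On a vector `v` of charge `l` annihilated by `βₙ`, `n ≥ -l`, and `γₙ`,
`n ≥ l`, these relations are recursions which express all `βₙ v`, `γₙ v` through Heisenberg modes
acting on the two neighbouring charged vacua. Hence the charged vacua generate the Fock space under
the Heisenberg algebra, every eigenspace of `J₀` is a highest weight module, and highest weight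
modules of the Heisenberg algebra are irreducible Fock spaces.

The differences `:∂βγ: - ½(:J²: + ∂J)` and `½(:∂²βγ: - :∂β∂γ:) - (4:J³: + 6:J∂J: + ∂²J)/12` commute
with the Heisenberg algebra, so by irreducibility their modes act on each charged vacuum by scalars.
By homogeneity only one mode can be nonzero, and there the two scalars agree: both equal
`l(l-1)/2`, respectively `l(l-1)(2l-1)/6`.
-/

noncomputable section

namespace BosonFermion

open VertexOperator

attribute [local instance] LieRing.ofAssociativeRing LieAlgebra.ofAssociativeAlgebra

theorem hasSum_finsum {ι M : Type*} [AddCommMonoid M] [TopologicalSpace M] {f : ι → M}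
    (hf : f.support.Finite) : HasSum f (∑ᶠ i, f i) := by
  rw [finsum_eq_sum f hf]
  exact hasSum_sum_of_ne_finset_zero fun i hi => by simpa using hi

section PointwiseSum

variable {R V ι κ : Type*} [CommRing R] [AddCommGroup V] [Module R V]

/-- Pointwise finite sums of operators, the meaning given to the infinite sums in normally ordered
products: on each vector only finitely many `f i` are nonzero and they sum up to `a`. This is
summability for the discrete topology on `V`. -/
def HasPointwiseSum (f : ι → Module.End R V) (a : Module.End R V) : Prop :=
  letI : TopologicalSpace V := ⊥
  ∀ v, HasSum (fun i => f i v) (a v)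

namespace HasPointwiseSum

variable {f g : ι → Module.End R V} {a a' : Module.End R V}

theorem map {W : Type*} [AddCommGroup W] [Module R W] {f' : ι → Module.End R W}
    {b : Module.End R W} (φ : V →ₗ[R] W) (h : HasPointwiseSum f a) (h' : HasPointwiseSum f' b)
    {v : V} (hφ : ∀ i, φ (f i v) = f' i (φ v)) : φ (a v) = b (φ v) := by
  let _ : TopologicalSpace V := ⊥
  have : DiscreteTopology V := ⟨rfl⟩
  let _ : TopologicalSpace W := ⊥
  have : DiscreteTopology W := ⟨rfl⟩
  exact ((h v).map φ continuous_of_discreteTopology).unique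
    (by simpa only [Function.comp_def, hφ] using h' (φ v))

theorem apply_eq (h : HasPointwiseSum f a) (h' : HasPointwiseSum g a') {v : V}
    (hfg : ∀ i, f i v = g i v) : a v = a' v :=
  h.map LinearMap.id h' hfg

theorem unique (h : HasPointwiseSum f a) (h' : HasPointwiseSum f a') : a = a' :=
  LinearMap.ext fun _ => h.apply_eq h' fun _ => rfl

theorem congr (h : HasPointwiseSum f a) (hfg : ∀ i, f i = g i) : HasPointwiseSum g a :=
  funext hfg ▸ h

theorem mem (h : HasPointwiseSum f a) {S : Submodule R V} {v : V} (hf : ∀ i, f i v ∈ S) :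
    a v ∈ S := by
  let _ : TopologicalSpace V := ⊥
  have : DiscreteTopology V := ⟨rfl⟩
  exact (isClosed_discrete (S : Set V)).mem_of_tendsto (h v)
    (.of_forall fun s => S.sum_mem fun i _ => hf i)

theorem apply_eq_zero (h : HasPointwiseSum f a) {v : V} (hf : ∀ i, f i v = 0) : a v = 0 :=
  (Submodule.mem_bot R).1 (h.mem fun i => (Submodule.mem_bot R).2 (hf i))

theorem add (h : HasPointwiseSum f a) (h' : HasPointwiseSum g a') :
    HasPointwiseSum (fun i => f i + g i) (a + a') := by
  let _ : TopologicalSpace V := ⊥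
  have : DiscreteTopology V := ⟨rfl⟩
  exact fun v => (h v).add (h' v)

theorem sub (h : HasPointwiseSum f a) (h' : HasPointwiseSum g a') :
    HasPointwiseSum (fun i => f i - g i) (a - a') := by
  let _ : TopologicalSpace V := ⊥
  have : DiscreteTopology V := ⟨rfl⟩
  exact fun v => (h v).sub (h' v)

theorem mul_left (X : Module.End R V) (h : HasPointwiseSum f a) :
    HasPointwiseSum (fun i => X * f i) (X * a) := by
  let _ : TopologicalSpace V := ⊥
  have : DiscreteTopology V := ⟨rfl⟩
  exact fun v => (h v).map X continuous_of_discreteTopology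

theorem mul_right (X : Module.End R V) (h : HasPointwiseSum f a) :
    HasPointwiseSum (fun i => f i * X) (a * X) :=
  fun v => h (X v)

theorem lie_left (X : Module.End R V) (h : HasPointwiseSum f a) :
    HasPointwiseSum (fun i => ⁅X, f i⁆) ⁅X, a⁆ :=
  (h.mul_left X).sub (h.mul_right X)

theorem smul (r : R) (h : HasPointwiseSum f a) : HasPointwiseSum (fun i => r • f i) (r • a) :=
  (h.mul_left (r • 1)).congr (fun i => smul_one_mul r (f i)) |> (smul_one_mul r a ▸ ·)

theorem comp_equiv (h : HasPointwiseSum f a) (e : κ ≃ ι) :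
    HasPointwiseSum (fun k => f (e k)) a :=
  let _ : TopologicalSpace V := ⊥
  fun v => e.hasSum_iff.2 (h v)

theorem shift {f : ℤ → Module.End R V} (h : HasPointwiseSum f a) (m : ℤ) :
    HasPointwiseSum (fun p => f (p + m)) a :=
  h.comp_equiv (Equiv.addRight m)

end HasPointwiseSum

theorem hasPointwiseSum_zero : HasPointwiseSum (fun _ : ι => (0 : Module.End R V)) 0 :=
  let _ : TopologicalSpace V := ⊥
  fun _ => hasSum_zero

theorem hasPointwiseSum_single [DecidableEq ι] (k : ι) (a : Module.End R V) :
    HasPointwiseSum (fun i => if i = k then a else 0) a := fun v => by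
  let _ : TopologicalSpace V := ⊥
  convert hasSum_ite_eq k (a v) using 2 with i
  exact apply_ite (fun X : Module.End R V => X v) (i = k) a 0

/-- A telescoping sum: the difference of the two step functions is supported on the interval between
`0` and `M`. -/
theorem hasPointwiseSum_step {g w : ℤ → R} (hg : ∀ k, g (k + 1) = g k + w k) (M : ℤ) :
    HasPointwiseSum
      (fun p => (w p * ((if M ≤ p then 1 else 0) - (if 0 ≤ p then 1 else 0))) •
        (1 : Module.End R V)) ((g 0 - g M) • 1) := by
  induction M using Int.induction_on with
  | zero => simpa using hasPointwiseSum_zero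
  | succ M ih =>
    have h := ih.sub (hasPointwiseSum_single (M : ℤ) (w M • (1 : Module.End R V)))
    rw [← sub_smul, show g 0 - g M - w M = g 0 - g (M + 1) by rw [hg]; ring] at h
    refine h.congr fun p => ?_
    rcases lt_trichotomy p M with hp | rfl | hp
    · simp [hp.ne, show ¬ (M : ℤ) ≤ p by lia, show ¬ (M : ℤ) + 1 ≤ p by lia]
    · simp
    · simp [hp.ne', hp.le, show (M : ℤ) + 1 ≤ p by lia]
  | pred M ih =>
    have h := ih.add (hasPointwiseSum_single (-M - 1 : ℤ) (w (-M - 1) • (1 : Module.End R V)))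
    have hM := hg (-M - 1)
    rw [sub_add_cancel] at hM
    rw [← add_smul, show g 0 - g (-M) + w (-M - 1) = g 0 - g (-M - 1) by rw [hM]; ring] at h
    refine h.congr fun p => ?_
    rcases lt_trichotomy p (-M - 1) with hp | rfl | hp
    · simp [hp.ne, show ¬ (-M : ℤ) ≤ p by lia, show ¬ (-M - 1 : ℤ) ≤ p by lia]
    · simp [show ¬ (1 : ℤ) ≤ -M by lia]
    · simp [hp.ne', hp.le, show (-M : ℤ) ≤ p by lia]

end PointwiseSum

theorem lie_mul {R : Type*} [Ring R] (x y z : R) : ⁅x, y * z⁆ = ⁅x, y⁆ * z + y * ⁅x, z⁆ := by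
  simp only [Ring.lie_def]
  noncomm_ring

section FieldOperations

variable {V : Type*} [AddCommGroup V] [Module ℂ V]

theorem field_ext {A B : VertexOperator ℂ V} (h : ∀ n, ncoeff A n = ncoeff B n) : A = B :=
  HVertexOperator.coeff_inj <| funext fun n => by
    simpa only [coeff_eq_ncoeff] using h (-n - 1)

/-- The product `A_p B_q` of two modes in normal order: annihilation modes `A_p`, `p ≥ 0`, are moved
to the right at the cost of the sign `ε`. -/
def wick (ε : ℤˣ) (A B : VertexOperator ℂ V) (p q : ℤ) : Module.End ℂ V :=
  if p < 0 then ncoeff A p * ncoeff B q else ((ε : ℤ) : ℂ) • (ncoeff B q * ncoeff A p)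

theorem wick_of_neg (ε : ℤˣ) (A B : VertexOperator ℂ V) {p : ℤ} (hp : p < 0) (q : ℤ) :
    wick ε A B p q = ncoeff A p * ncoeff B q :=
  if_pos hp

theorem wick_of_nonneg (ε : ℤˣ) (A B : VertexOperator ℂ V) {p : ℤ} (hp : 0 ≤ p) (q : ℤ) :
    wick ε A B p q = ((ε : ℤ) : ℂ) • (ncoeff B q * ncoeff A p) :=
  if_neg hp.not_gt

theorem hasPointwiseSum_normalMode (ε : ℤˣ) (A B : VertexOperator ℂ V) (n : ℤ) :
    HasPointwiseSum (fun p => wick ε A B p (n - 1 - p)) (normalMode ε A B n) := by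
  intro v
  let _ : TopologicalSpace V := ⊥
  have : DiscreteTopology V := ⟨rfl⟩
  have hneg := hasSum_finsum (finite_support_left A B n v)
  have hnonneg := hasSum_finsum (finite_support_right A B n v)
  have hsmul := hnonneg.map (DistribSMul.toAddMonoidHom V ((ε : ℤ) : ℂ))
    continuous_of_discreteTopology
  have hsum : HasSum (fun p => wick ε A B p (n - 1 - p) v) _ :=
    HasSum.of_nat_of_neg_add_one
      (hsmul.congr_fun fun k => ?_) (hneg.congr_fun fun k => ?_)
  · rwa [add_comm] at hsum
  · rw [wick_of_nonneg _ _ _ (by lia), sub_right_comm]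
    rfl
  · rw [wick_of_neg _ _ _ (by lia), neg_add', show n - 1 - (-(k : ℤ) - 1) = n + k by ring]
    rfl

@[simp]
theorem ncoeff_normalOrder (ε : ℤˣ) (A B : VertexOperator ℂ V) (n : ℤ) :
    ncoeff (normalOrder ε A B) n = normalMode ε A B n :=
  ncoeff_ofModes _ _ _

@[simp]
theorem ncoeff_fieldDeriv (A : VertexOperator ℂ V) (n : ℤ) :
    ncoeff (fieldDeriv A) n = (-n : ℂ) • ncoeff A (n - 1) :=
  ncoeff_ofModes _ _ _

end FieldOperations

section Intertwines

variable {V W : Type*} [AddCommGroup V] [Module ℂ V] [AddCommGroup W] [Module ℂ W]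

/-- The linear map `φ` intertwines the modes of the fields `A` and `B`. -/
def Intertwines (φ : V →ₗ[ℂ] W) (A : VertexOperator ℂ V) (B : VertexOperator ℂ W) : Prop :=
  ∀ (n : ℤ) (x : V), φ (ncoeff A n x) = ncoeff B n (φ x)

namespace Intertwines

variable {φ : V →ₗ[ℂ] W} {A A' : VertexOperator ℂ V} {B B' : VertexOperator ℂ W}

theorem add (h : Intertwines φ A B) (h' : Intertwines φ A' B') :
    Intertwines φ (A + A') (B + B') := fun n x => by
  simp only [map_add, Pi.add_apply, LinearMap.add_apply, h n x, h' n x]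

theorem smul (r : ℂ) (h : Intertwines φ A B) : Intertwines φ (r • A) (r • B) := fun n x => by
  simp only [map_smul, Pi.smul_apply, LinearMap.smul_apply, h n x]

theorem fieldDeriv (h : Intertwines φ A B) :
    Intertwines φ (fieldDeriv A) (fieldDeriv B) := fun n x => by
  simp only [ncoeff_fieldDeriv, LinearMap.smul_apply, map_smul, h (n - 1) x]

theorem normalOrder (ε : ℤˣ) (h : Intertwines φ A B) (h' : Intertwines φ A' B') :
    Intertwines φ (normalOrder ε A A') (normalOrder ε B B') := fun n x => by
  rw [ncoeff_normalOrder, ncoeff_normalOrder]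
  refine (hasPointwiseSum_normalMode ε A A' n).map φ (hasPointwiseSum_normalMode ε B B' n)
    fun p => ?_
  rcases lt_or_ge p 0 with hp | hp
  · simp only [wick_of_neg _ _ _ hp, Module.End.mul_apply, h _ _, h' _ _]
  · simp only [wick_of_nonneg _ _ _ hp, LinearMap.smul_apply, Module.End.mul_apply, map_smul,
      h _ _, h' _ _]

end Intertwines

end Intertwines

section HasWeight

variable {V : Type*} [AddCommGroup V] [Module ℂ V]

/-- The field `A` is homogeneous of conformal weight `Δ` with respect to the energy operator `L`:
`[L, Aₙ] = (Δ - n - 1) Aₙ`. -/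
def HasWeight (L : Module.End ℂ V) (A : VertexOperator ℂ V) (Δ : ℂ) : Prop :=
  ∀ n : ℤ, ⁅L, ncoeff A n⁆ = (Δ - n - 1) • ncoeff A n

namespace HasWeight

variable {L : Module.End ℂ V} {A B : VertexOperator ℂ V} {Δ Δ' : ℂ}

theorem add (hA : HasWeight L A Δ) (hB : HasWeight L B Δ) : HasWeight L (A + B) Δ := fun n => by
  simp only [map_add, Pi.add_apply, lie_add, hA n, hB n, smul_add]

theorem smul (r : ℂ) (hA : HasWeight L A Δ) : HasWeight L (r • A) Δ := fun n => by
  simp only [map_smul, Pi.smul_apply, lie_smul, hA n, smul_comm r]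

theorem sub (hA : HasWeight L A Δ) (hB : HasWeight L B Δ) : HasWeight L (A - B) Δ := fun n => by
  simp only [map_sub, Pi.sub_apply, lie_sub, hA n, hB n, smul_sub]

theorem fieldDeriv (hA : HasWeight L A Δ) : HasWeight L (fieldDeriv A) (Δ + 1) := fun n => by
  rw [ncoeff_fieldDeriv, lie_smul, hA (n - 1), smul_comm]
  congr 2
  push_cast
  ring

theorem normalOrder (ε : ℤˣ) (hA : HasWeight L A Δ) (hB : HasWeight L B Δ') :
    HasWeight L (normalOrder ε A B) (Δ + Δ') := fun n => by
  rw [ncoeff_normalOrder]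
  refine ((hasPointwiseSum_normalMode ε A B n).lie_left L).unique
    (((hasPointwiseSum_normalMode ε A B n).smul _).congr fun p => ?_)
  rcases lt_or_ge p 0 with hp | hp
  · rw [wick_of_neg _ _ _ hp, lie_mul, hA, hB, smul_mul_assoc, mul_smul_comm, ← add_smul]
    congr 1
    push_cast
    ring
  · rw [wick_of_nonneg _ _ _ hp, lie_smul, lie_mul, hA, hB, smul_mul_assoc, mul_smul_comm,
      ← add_smul, smul_comm]
    congr 2
    push_cast
    ring

end HasWeight

end HasWeight

section HasTopMode

variable {V : Type*} [AddCommGroup V] [Module ℂ V]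

/-- On `v` the modes `Aₙ`, `n > d`, of the field `A` vanish and `A_d` acts by the scalar `r`. Thus
`HasTopMode J 0 α v` says that `v` is a highest weight vector of weight `α` for the Heisenberg modes
of `J`. -/
structure HasTopMode (A : VertexOperator ℂ V) (d : ℤ) (r : ℂ) (v : V) : Prop where
  apply_top : ncoeff A d v = r • v
  apply_of_lt {n : ℤ} (hn : d < n) : ncoeff A n v = 0

namespace HasTopMode

variable {A B J : VertexOperator ℂ V} {d : ℤ} {r s α : ℂ} {v : V}

theorem add (hA : HasTopMode A d r v) (hB : HasTopMode B d s v) :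
    HasTopMode (A + B) d (r + s) v where
  apply_top := by
    rw [map_add, Pi.add_apply, LinearMap.add_apply, hA.apply_top, hB.apply_top, add_smul]
  apply_of_lt hn := by
    rw [map_add, Pi.add_apply, LinearMap.add_apply, hA.apply_of_lt hn, hB.apply_of_lt hn, add_zero]

theorem smul (c : ℂ) (hA : HasTopMode A d r v) : HasTopMode (c • A) d (c * r) v where
  apply_top := by rw [map_smul, Pi.smul_apply, LinearMap.smul_apply, hA.apply_top, mul_smul]
  apply_of_lt hn := by
    rw [map_smul, Pi.smul_apply, LinearMap.smul_apply, hA.apply_of_lt hn, smul_zero]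

theorem fieldDeriv (hA : HasTopMode A d r v) :
    HasTopMode (fieldDeriv A) (d + 1) (-(d + 1) * r) v where
  apply_top := by
    rw [ncoeff_fieldDeriv, LinearMap.smul_apply, add_sub_cancel_right, hA.apply_top, mul_smul,
      Int.cast_add, Int.cast_one]
  apply_of_lt hn := by
    rw [ncoeff_fieldDeriv, LinearMap.smul_apply, hA.apply_of_lt (by lia), smul_zero]

theorem nopEven (hJ : HasTopMode J 0 α v) (hA : HasTopMode A d r v) :
    HasTopMode (nopEven J A) (d + 1) (α * r) v where
  apply_top := by
    rw [ncoeff_normalOrder]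
    refine (hasPointwiseSum_normalMode 1 J A (d + 1)).apply_eq
      (hasPointwiseSum_single 0 ((α * r) • 1)) fun p => ?_
    rcases lt_trichotomy p 0 with hp | rfl | hp
    · rw [wick_of_neg _ _ _ hp, Module.End.mul_apply, hA.apply_of_lt (by lia), map_zero,
        if_neg hp.ne, LinearMap.zero_apply]
    · rw [wick_of_nonneg _ _ _ le_rfl, LinearMap.smul_apply, Module.End.mul_apply, hJ.apply_top,
        map_smul, show d + 1 - 1 - 0 = d by ring, hA.apply_top, if_pos rfl]
      simp [mul_smul]
    · rw [wick_of_nonneg _ _ _ hp.le, LinearMap.smul_apply, Module.End.mul_apply,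
        hJ.apply_of_lt hp, map_zero, smul_zero, if_neg hp.ne', LinearMap.zero_apply]
  apply_of_lt {n} hn := by
    rw [ncoeff_normalOrder]
    refine (hasPointwiseSum_normalMode 1 J A n).apply_eq_zero fun p => ?_
    rcases lt_trichotomy p 0 with hp | rfl | hp
    · rw [wick_of_neg _ _ _ hp, Module.End.mul_apply, hA.apply_of_lt (by lia), map_zero]
    · rw [wick_of_nonneg _ _ _ le_rfl, LinearMap.smul_apply, Module.End.mul_apply, hJ.apply_top,
        map_smul, hA.apply_of_lt (by lia), smul_zero, smul_zero]
    · rw [wick_of_nonneg _ _ _ hp.le, LinearMap.smul_apply, Module.End.mul_apply,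
        hJ.apply_of_lt hp, map_zero, smul_zero]

end HasTopMode

end HasTopMode

section Heisenberg

variable {V : Type*} [AddCommGroup V] [Module ℂ V]

/-- The constant field `1`, with `-1`-st mode the identity and all other modes zero. It allows the
central terms of commutators to be written as modes of a field. -/
def identityField : VertexOperator ℂ V :=
  ofModes (fun n => if n = -1 then 1 else 0) fun _ => ⟨0, fun n hn => by
    rw [if_neg (by lia), LinearMap.zero_apply]⟩

theorem ncoeff_identityField (n : ℤ) :
    ncoeff (identityField : VertexOperator ℂ V) n = if n = -1 then 1 else 0 :=
  ncoeff_ofModes _ _ _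

theorem smul_ncoeff_identityField_congr {r s : ℂ} {n : ℤ} (h : n = -1 → r = s) :
    r • ncoeff (identityField : VertexOperator ℂ V) n = s • ncoeff identityField n := by
  rw [ncoeff_identityField]
  split_ifs with hn
  · rw [h hn]
  · simp only [smul_zero]

/-- The modes of the field `J` represent the Heisenberg algebra, `[Jₘ, Jₙ] = m δ_{m,-n}`. -/
def IsHeisenberg (J : VertexOperator ℂ V) : Prop :=
  ∀ m n : ℤ, ⁅ncoeff J m, ncoeff J n⁆ = if m + n = 0 then (m : ℂ) • 1 else 0

/-- The bosonic stress tensor `½(:J²: + ∂J)`. -/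
def bosonStress (J : VertexOperator ℂ V) : VertexOperator ℂ V :=
  (1 / 2 : ℂ) • (nopEven J J + fieldDeriv J)

/-- The bosonic field `(4:J³: + 6:J∂J: + ∂²J)/12` of weight three. -/
def bosonCubic (J : VertexOperator ℂ V) : VertexOperator ℂ V :=
  (1 / 12 : ℂ) • ((4 : ℂ) • nopEven J (nopEven J J) + (6 : ℂ) • nopEven J (fieldDeriv J) +
    fieldDeriv (fieldDeriv J))

variable {J : VertexOperator ℂ V}

theorem nopEven_identityField (J : VertexOperator ℂ V) : nopEven J identityField = J :=
  field_ext fun n => by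
    rw [ncoeff_normalOrder]
    refine (hasPointwiseSum_normalMode 1 J identityField n).unique
      ((hasPointwiseSum_single n (ncoeff J n)).congr fun p => ?_)
    have hp : n - 1 - p = -1 ↔ p = n := by lia
    by_cases hn : p = n <;> simp [wick, ncoeff_identityField, hp, hn]

namespace IsHeisenberg

theorem lie_eq_identityField (hJ : IsHeisenberg J) (m n : ℤ) :
    ⁅ncoeff J m, ncoeff J n⁆ = (m : ℂ) • ncoeff identityField (n + (m - 1)) := by
  rw [hJ, ncoeff_identityField, smul_ite, smul_zero]
  exact if_congr (by lia) rfl rfl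

theorem lie_nopEven (hJ : IsHeisenberg J) {B C : VertexOperator ℂ V} {m d : ℤ} {r : ℂ}
    (hB : ∀ n, ⁅ncoeff J m, ncoeff B n⁆ = r • ncoeff C (n + d)) (n : ℤ) :
    ⁅ncoeff J m, ncoeff (nopEven J B) n⁆ =
      (m : ℂ) • ncoeff B (n + (m - 1)) + r • ncoeff (nopEven J C) (n + d) := by
  simp only [ncoeff_normalOrder]
  refine ((hasPointwiseSum_normalMode 1 J B n).lie_left _).unique
    (((hasPointwiseSum_single (-m) ((m : ℂ) • ncoeff B (n + (m - 1)))).add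
      ((hasPointwiseSum_normalMode 1 J C (n + d)).smul r)).congr fun p => ?_)
  have hJp : ⁅ncoeff J m, ncoeff J p⁆ = if p = -m then (m : ℂ) • 1 else 0 := by
    rw [hJ]
    exact if_congr (by lia) rfl rfl
  have hBp : (if p = -m then (m : ℂ) • ncoeff B (n + (m - 1)) else 0) =
      if p = -m then (m : ℂ) • ncoeff B (n - 1 - p) else 0 := by
    split_ifs with h
    · rw [h, show n - 1 - -m = n + (m - 1) by ring]
    · rfl
  rw [hBp, show n + d - 1 - p = n - 1 - p + d by ring]
  rcases lt_or_ge p 0 with hp | hp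
  · simp only [wick_of_neg _ _ _ hp, lie_mul, hJp, hB, ite_mul, smul_mul_assoc, one_mul, zero_mul,
      mul_smul_comm]
  · simp only [wick_of_nonneg _ _ _ hp, Units.val_one, Int.cast_one, one_smul, lie_mul, hJp, hB,
      mul_ite, mul_smul_comm, mul_one, mul_zero, smul_mul_assoc, add_comm]

theorem lie_sq (hJ : IsHeisenberg J) (m n : ℤ) :
    ⁅ncoeff J m, ncoeff (nopEven J J) n⁆ = (2 * m : ℂ) • ncoeff J (n + (m - 1)) := by
  rw [hJ.lie_nopEven (hJ.lie_eq_identityField m), nopEven_identityField, ← add_smul, two_mul]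

theorem lie_cube (hJ : IsHeisenberg J) (m n : ℤ) :
    ⁅ncoeff J m, ncoeff (nopEven J (nopEven J J)) n⁆ =
      (3 * m : ℂ) • ncoeff (nopEven J J) (n + (m - 1)) := by
  rw [hJ.lie_nopEven (hJ.lie_sq m), ← add_smul]
  ring_nf

theorem lie_fieldDeriv (hJ : IsHeisenberg J) (m n : ℤ) :
    ⁅ncoeff J m, ncoeff (fieldDeriv J) n⁆ =
      (m * (m - 1) : ℂ) • ncoeff identityField (n + (m - 2)) := by
  rw [ncoeff_fieldDeriv, lie_smul, hJ.lie_eq_identityField, smul_smul,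
    show n - 1 + (m - 1) = n + (m - 2) by ring]
  refine smul_ncoeff_identityField_congr fun h => ?_
  rw [show n = 1 - m by lia]
  push_cast
  ring

theorem lie_fieldDeriv_fieldDeriv (hJ : IsHeisenberg J) (m n : ℤ) :
    ⁅ncoeff J m, ncoeff (fieldDeriv (fieldDeriv J)) n⁆ =
      (m * (m - 1) * (m - 2) : ℂ) • ncoeff identityField (n + (m - 3)) := by
  rw [ncoeff_fieldDeriv, lie_smul, hJ.lie_fieldDeriv, smul_smul,
    show n - 1 + (m - 2) = n + (m - 3) by ring]
  refine smul_ncoeff_identityField_congr fun h => ?_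
  rw [show n = 2 - m by lia]
  push_cast
  ring

theorem lie_nopEven_fieldDeriv (hJ : IsHeisenberg J) (m n : ℤ) :
    ⁅ncoeff J m, ncoeff (nopEven J (fieldDeriv J)) n⁆ =
      (-(m * n) : ℂ) • ncoeff J (n + (m - 2)) := by
  rw [hJ.lie_nopEven (hJ.lie_fieldDeriv m), nopEven_identityField, ncoeff_fieldDeriv,
    smul_smul, show n + (m - 1) - 1 = n + (m - 2) by ring, ← add_smul]
  push_cast
  ring_nf

theorem lie_bosonStress (hJ : IsHeisenberg J) (m n : ℤ) :
    ⁅ncoeff J m, ncoeff (bosonStress J) n⁆ = (m : ℂ) • ncoeff J (n + (m - 1)) +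
      (m * (m - 1) / 2 : ℂ) • ncoeff identityField (n + (m - 2)) := by
  rw [bosonStress, map_smul, Pi.smul_apply, map_add, Pi.add_apply, lie_smul, lie_add, hJ.lie_sq,
    hJ.lie_fieldDeriv]
  module

theorem lie_bosonCubic (hJ : IsHeisenberg J) (m n : ℤ) :
    ⁅ncoeff J m, ncoeff (bosonCubic J) n⁆ = (2 * m : ℂ) • ncoeff (bosonStress J) (n + (m - 1)) +
      (m * (n + 2 * m - 2) / 2 : ℂ) • ncoeff J (n + (m - 2)) +
      (m * (m - 1) * (m - 2) / 12 : ℂ) • ncoeff identityField (n + (m - 3)) := by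
  simp only [bosonCubic, bosonStress, map_smul, Pi.smul_apply, map_add, Pi.add_apply, lie_smul,
    lie_add, hJ.lie_cube, hJ.lie_nopEven_fieldDeriv, hJ.lie_fieldDeriv_fieldDeriv]
  rw [ncoeff_fieldDeriv J, show n + (m - 1) - 1 = n + (m - 2) by ring]
  push_cast
  module

end IsHeisenberg

theorem HasWeight.bosonStress {L : Module.End ℂ V} (hJ : HasWeight L J 1) :
    HasWeight L (bosonStress J) 2 := by
  have h := ((hJ.normalOrder 1 hJ).add hJ.fieldDeriv).smul (1 / 2)
  rwa [one_add_one_eq_two] at h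

theorem HasWeight.bosonCubic {L : Module.End ℂ V} (hJ : HasWeight L J 1) :
    HasWeight L (bosonCubic J) 3 := by
  have hcube := hJ.normalOrder 1 (hJ.normalOrder 1 hJ)
  have hderiv := hJ.normalOrder 1 hJ.fieldDeriv
  have h := (((hcube.smul 4).add (hderiv.smul 6)).add
    (by simpa only [add_assoc] using hJ.fieldDeriv.fieldDeriv)).smul (1 / 12)
  rwa [show (1 + (1 + 1) : ℂ) = 3 by norm_num] at h

theorem HasTopMode.bosonStress {α : ℂ} {v : V} (hJ : HasTopMode J 0 α v) :
    HasTopMode (bosonStress J) 1 (α * (α - 1) / 2) v := by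
  have h : HasTopMode (BosonFermion.bosonStress J) 1 _ v :=
    ((hJ.nopEven hJ).add hJ.fieldDeriv).smul (1 / 2)
  convert h using 1
  push_cast
  ring

theorem HasTopMode.bosonCubic {α : ℂ} {v : V} (hJ : HasTopMode J 0 α v) :
    HasTopMode (bosonCubic J) 2 (α * (α - 1) * (2 * α - 1) / 6) v := by
  have h : HasTopMode (BosonFermion.bosonCubic J) 2 _ v :=
    ((((hJ.nopEven (hJ.nopEven hJ)).smul 4).add ((hJ.nopEven hJ.fieldDeriv).smul 6)).add
      hJ.fieldDeriv.fieldDeriv).smul (1 / 12)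
  convert h using 1
  push_cast
  ring

theorem Intertwines.bosonStress {W : Type*} [AddCommGroup W] [Module ℂ W] {φ : V →ₗ[ℂ] W}
    {K : VertexOperator ℂ W} (h : Intertwines φ J K) :
    Intertwines φ (bosonStress J) (bosonStress K) :=
  ((h.normalOrder 1 h).add h.fieldDeriv).smul _

theorem Intertwines.bosonCubic {W : Type*} [AddCommGroup W] [Module ℂ W] {φ : V →ₗ[ℂ] W}
    {K : VertexOperator ℂ W} (h : Intertwines φ J K) :
    Intertwines φ (bosonCubic J) (bosonCubic K) :=
  ((((h.normalOrder 1 (h.normalOrder 1 h)).smul 4).add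
    ((h.normalOrder 1 h.fieldDeriv).smul 6)).add h.fieldDeriv.fieldDeriv).smul _

end Heisenberg

section MvPolynomial

open MvPolynomial

variable {σ R : Type*}

theorem exists_aeval_of_commute {A : Type*} [CommRing R] [Ring A] [Algebra R A] (f : σ → A)
    (hf : ∀ i k, f i * f k = f k * f i) :
    ∃ φ : MvPolynomial σ R →ₐ[R] A, ∀ i, φ (X i) = f i := by
  have hcomm : ∀ x ∈ Set.range f, ∀ y ∈ Set.range f, x * y = y * x := by
    rintro _ ⟨i, rfl⟩ _ ⟨k, rfl⟩
    exact hf i k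
  let _ : CommRing (Algebra.adjoin R (Set.range f)) :=
    { (Algebra.adjoin R (Set.range f)).toRing with
      mul_comm := (Algebra.isMulCommutative_adjoin R hcomm).is_comm.comm }
  let φ := aeval (R := R) fun i => (⟨f i, Algebra.subset_adjoin ⟨i, rfl⟩⟩ :
    Algebra.adjoin R (Set.range f))
  exact ⟨(Algebra.adjoin R (Set.range f)).val.comp φ, fun i => by simp [φ]⟩

variable [CommSemiring R]

theorem eq_C_of_pderiv_eq_zero [CharZero R] [NoZeroDivisors R] {p : MvPolynomial σ R}
    (h : ∀ i, pderiv i p = 0) : p = C (p.coeff 0) := by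
  classical
  ext m
  rw [coeff_C]
  split_ifs with hm
  · rw [hm]
  · obtain ⟨i, hi⟩ : ∃ i, m i ≠ 0 := Finsupp.ne_iff.1 (Ne.symm hm)
    have hcoeff := congrArg (coeff (m - Finsupp.single i 1)) (h i)
    rw [coeff_pderiv, coeff_zero,
      tsub_add_cancel_of_le (Finsupp.single_le_iff.2 (Nat.one_le_iff_ne_zero.2 hi))] at hcoeff
    exact (mul_eq_zero.1 hcoeff).resolve_right (Nat.cast_add_one_ne_zero _)

theorem totalDegree_pderiv_lt {p : MvPolynomial σ R} {i : σ} (h : pderiv i p ≠ 0) :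
    (pderiv i p).totalDegree < p.totalDegree := by
  obtain ⟨m, hm, hdeg⟩ := Finset.exists_mem_eq_sup _ (support_nonempty.2 h)
    fun m : σ →₀ ℕ => m.degree
  rw [mem_support_iff, coeff_pderiv] at hm
  calc (pderiv i p).totalDegree = m.degree := hdeg
    _ < (m + Finsupp.single i 1).degree := by simp
    _ ≤ p.totalDegree := le_totalDegree (mem_support_iff.2 (left_ne_zero_of_mul hm))

end MvPolynomial

section HeisenbergFock

open MvPolynomial

theorem ncoeff_jH (α : ℂ) (n : ℤ) : ncoeff (jH α) n = heisMode α n :=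
  ncoeff_ofModes _ _ _

theorem jH_zero_apply (α : ℂ) (p : Heis) : ncoeff (jH α) 0 p = α • p := by
  rw [ncoeff_jH]
  rfl

theorem jH_natCast_add_one_apply (α : ℂ) (k : ℕ) (p : Heis) :
    ncoeff (jH α) (k + 1) p = (k + 1 : ℂ) • pderiv k p := by
  rw [ncoeff_jH]
  rfl

theorem jH_negSucc_apply (α : ℂ) (k : ℕ) (p : Heis) :
    ncoeff (jH α) (Int.negSucc k) p = X k * p := by
  rw [ncoeff_jH]
  rfl

theorem lie_jH_negSucc (α : ℂ) (n : ℤ) (i : ℕ) :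
    ⁅ncoeff (jH α) n, ncoeff (jH α) (Int.negSucc i)⁆ =
      if n + Int.negSucc i = 0 then (n : ℂ) • 1 else 0 := by
  refine LinearMap.ext fun p => ?_
  rw [Ring.lie_def, LinearMap.sub_apply, Module.End.mul_apply, Module.End.mul_apply,
    jH_negSucc_apply, jH_negSucc_apply]
  obtain (_ | k) | k := n
  · simp [jH_zero_apply]
  · simp only [Int.ofNat_eq_natCast, Nat.cast_add_one, jH_natCast_add_one_apply]
    rw [Derivation.leibniz, pderiv_X]
    rcases eq_or_ne k i with rfl | h
    · rw [Pi.single_eq_same, if_pos (by lia), smul_eq_mul, smul_eq_mul, mul_one, smul_add,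
        mul_smul_comm, add_sub_cancel_left, LinearMap.smul_apply, Module.End.one_apply]
      push_cast
      rfl
    · rw [Pi.single_eq_of_ne h.symm, if_neg (by lia)]
      simp
  · rw [jH_negSucc_apply, jH_negSucc_apply, if_neg (by lia), mul_left_comm, sub_self,
      LinearMap.zero_apply]

theorem submodule_heis_eq_top {S : Submodule ℂ Heis} (hone : 1 ∈ S)
    (hX : ∀ (k : ℕ) (p : Heis), p ∈ S → X k * p ∈ S) : S = ⊤ := by
  refine Submodule.eq_top_iff'.2 fun p => ?_
  induction p using MvPolynomial.induction_on with
  | C a => simpa [smul_eq_C_mul] using S.smul_mem a hone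
  | add p q hp hq => exact S.add_mem hp hq
  | mul_X p k hp => exact mul_comm (X k) p ▸ hX k p hp

end HeisenbergFock

section HighestWeight

open MvPolynomial

variable {V : Type*} [AddCommGroup V] [Module ℂ V] {J : VertexOperator ℂ V} {α : ℂ} {v : V}

/-- The subspace generated from `v` by the modes of the field `J`. -/
def cyclicSpan (J : VertexOperator ℂ V) (v : V) : Submodule ℂ V :=
  sInf {S | v ∈ S ∧ ∀ m : ℤ, ∀ u ∈ S, ncoeff J m u ∈ S}

theorem self_mem_cyclicSpan (J : VertexOperator ℂ V) (v : V) : v ∈ cyclicSpan J v :=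
  Submodule.mem_sInf.2 fun _ hS => hS.1

theorem ncoeff_mem_cyclicSpan (m : ℤ) {u : V} (hu : u ∈ cyclicSpan J v) :
    ncoeff J m u ∈ cyclicSpan J v :=
  Submodule.mem_sInf.2 fun S hS => hS.2 m u (Submodule.mem_sInf.1 hu S hS)

theorem cyclicSpan_le {S : Submodule ℂ V} (hv : v ∈ S)
    (hS : ∀ m : ℤ, ∀ u ∈ S, ncoeff J m u ∈ S) : cyclicSpan J v ≤ S :=
  sInf_le ⟨hv, hS⟩

/-- `ψ` lets a polynomial in the creation operators act on `v`. It intertwines the annihilation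
operators because these satisfy the same commutation relations with the creation operators on both
sides and act in the same way on the vacuum vectors. -/
theorem HasTopMode.exists_intertwines (hv : HasTopMode J 0 α v) (hJ : IsHeisenberg J) :
    ∃ ψ : Heis →ₗ[ℂ] V, ψ 1 = v ∧ Intertwines ψ (jH α) J := by
  obtain ⟨φ, hφ⟩ := exists_aeval_of_commute (R := ℂ) (fun k : ℕ => ncoeff J (Int.negSucc k))
    fun i k => by
      rw [← sub_eq_zero, ← Ring.lie_def, hJ, if_neg (by lia)]
  obtain ⟨ψ, hone, hcreate⟩ : ∃ ψ : Heis →ₗ[ℂ] V, ψ 1 = v ∧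
      ∀ (k : ℕ) (p : Heis), ψ (X k * p) = ncoeff J (Int.negSucc k) (ψ p) :=
    ⟨(LinearMap.applyₗ v).comp φ.toLinearMap, by simp, fun k p => by simp [hφ]⟩
  refine ⟨ψ, hone, fun n p => ?_⟩
  suffices h : LinearMap.eqLocus (ψ ∘ₗ ncoeff (jH α) n) (ncoeff J n ∘ₗ ψ) = ⊤ from
    Submodule.eq_top_iff'.1 h p
  refine submodule_heis_eq_top ?_ fun k p hp => ?_
  · rw [LinearMap.mem_eqLocus, LinearMap.comp_apply, LinearMap.comp_apply, hone]
    obtain (_ | k) | k := n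
    · exact (congrArg ψ (jH_zero_apply α 1)).trans (by rw [map_smul, hone, ← hv.apply_top]; rfl)
    · refine (congrArg ψ (jH_natCast_add_one_apply α k 1)).trans ?_
      rw [pderiv_one, smul_zero, map_zero]
      exact (hv.apply_of_lt (by lia)).symm
    · rw [jH_negSucc_apply, hcreate, hone]
  · rw [LinearMap.mem_eqLocus, LinearMap.comp_apply, LinearMap.comp_apply] at hp ⊢
    have hlie := congrArg ψ (LinearMap.congr_fun (lie_jH_negSucc α n k) p)
    have hlie' := LinearMap.congr_fun (hJ n (Int.negSucc k)) (ψ p)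
    rw [Ring.lie_def, LinearMap.sub_apply, Module.End.mul_apply, Module.End.mul_apply] at hlie hlie'
    rw [map_sub, jH_negSucc_apply, jH_negSucc_apply, hcreate, hp] at hlie
    rw [hcreate, ← sub_left_inj, hlie, hlie']
    split_ifs <;> simp

theorem Intertwines.map_pderiv {ψ : Heis →ₗ[ℂ] V} (hψ : Intertwines ψ (jH α) J) {p : Heis}
    {k : ℕ} (hp : ncoeff J (k + 1) (ψ p) = 0) : ψ (pderiv k p) = 0 := by
  rw [← hψ, jH_natCast_add_one_apply, map_smul] at hp
  exact (smul_eq_zero.1 hp).resolve_left (Nat.cast_add_one_ne_zero k)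

theorem eq_smul_one_of_pderiv_eq_zero {p : Heis} (h : ∀ k, pderiv k p = 0) :
    ∃ r : ℂ, p = r • 1 :=
  ⟨p.coeff 0, by rw [smul_eq_C_mul, mul_one]; exact eq_C_of_pderiv_eq_zero h⟩

theorem Intertwines.injective {ψ : Heis →ₗ[ℂ] V} (hψ : Intertwines ψ (jH α) J) (h1 : ψ 1 ≠ 0) :
    Function.Injective ψ := by
  refine (injective_iff_map_eq_zero ψ).2 fun p => ?_
  induction hd : p.totalDegree using Nat.strong_induction_on generalizing p with
  | _ d ih =>
    intro hp
    have hder (k : ℕ) : pderiv k p = 0 := by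
      by_contra hk
      refine hk (ih _ (hd ▸ totalDegree_pderiv_lt hk) _ rfl (hψ.map_pderiv ?_))
      rw [hp, map_zero]
    obtain ⟨r, rfl⟩ := eq_smul_one_of_pderiv_eq_zero hder
    rw [map_smul] at hp
    rw [(smul_eq_zero.1 hp).resolve_right h1, zero_smul]

theorem Intertwines.range_eq_cyclicSpan {ψ : Heis →ₗ[ℂ] V} (hψ : Intertwines ψ (jH α) J) :
    LinearMap.range ψ = cyclicSpan J (ψ 1) := by
  refine le_antisymm ?_ (cyclicSpan_le ⟨1, rfl⟩ ?_)
  · rw [LinearMap.range_le_iff_comap]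
    refine submodule_heis_eq_top (self_mem_cyclicSpan J _) fun k p hp => ?_
    rw [Submodule.mem_comap, ← jH_negSucc_apply α, hψ]
    exact ncoeff_mem_cyclicSpan _ hp
  · rintro n _ ⟨p, rfl⟩
    exact ⟨_, hψ n p⟩

theorem HasTopMode.exists_eq_smul (hv : HasTopMode J 0 α v) (hJ : IsHeisenberg J)
    (hv0 : v ≠ 0) {u : V} (hu : u ∈ cyclicSpan J v)
    (hpos : ∀ m : ℤ, 0 < m → ncoeff J m u = 0) : ∃ r : ℂ, u = r • v := by
  obtain ⟨ψ, rfl, hψ⟩ := hv.exists_intertwines hJ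
  rw [← hψ.range_eq_cyclicSpan] at hu
  obtain ⟨p, rfl⟩ := hu
  obtain ⟨r, rfl⟩ := eq_smul_one_of_pderiv_eq_zero fun k =>
    hψ.injective hv0 ((hψ.map_pderiv (hpos _ (by lia))).trans (map_zero ψ).symm)
  exact ⟨r, map_smul ψ r 1⟩

end HighestWeight

section FermionPair

variable {V : Type*} [AddCommGroup V] [Module ℂ V]

/-- The canonical anticommutation relations of a pair of fermionic fields,
`[βₘ, γₙ]₊ = δ_{m+n+1,0}` and `[βₘ, βₙ]₊ = [γₘ, γₙ]₊ = 0`, with all modes indexed as in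
`∑ₙ Aₙ z^{-n-1}`. -/
structure IsFermionPair (β γ : VertexOperator ℂ V) : Prop where
  beta_beta (m n : ℤ) : ncoeff β m * ncoeff β n + ncoeff β n * ncoeff β m = 0
  gamma_gamma (m n : ℤ) : ncoeff γ m * ncoeff γ n + ncoeff γ n * ncoeff γ m = 0
  beta_gamma (m n : ℤ) :
    ncoeff β m * ncoeff γ n + ncoeff γ n * ncoeff β m = if m + n + 1 = 0 then 1 else 0

/-- The field with modes `w n • Aₙ`. -/
def weighted (w : ℤ → ℂ) (A : VertexOperator ℂ V) : VertexOperator ℂ V :=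
  ofModes (fun n => w n • ncoeff A n) fun v => by
    obtain ⟨N, hN⟩ := exists_ncoeff_eq_zero A v
    exact ⟨N, fun n hn => by simp [hN n hn]⟩

theorem hasPointwiseSum_normalMode_weighted (β γ : VertexOperator ℂ V) (w : ℤ → ℂ) (n : ℤ) :
    HasPointwiseSum (fun p => w p • wick (-1) β γ p (n - 1 - p))
      (normalMode (-1) (weighted w β) γ n) := by
  refine (hasPointwiseSum_normalMode (-1) (weighted w β) γ n).congr fun p => ?_
  unfold wick weighted
  rw [ncoeff_ofModes, smul_mul_assoc, mul_smul_comm, smul_comm, smul_ite]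

/-- The quadratic operator `∑ₚ w(p) :βₚ γₙ₋₁₋ₚ:` as a function of the weight `w`; the modes of the
current, the stress tensor and the cubic field are of this form, with `w` polynomial. -/
def bilin (β γ : VertexOperator ℂ V) (n : ℤ) : (ℤ → ℂ) →ₗ[ℂ] Module.End ℂ V where
  toFun w := normalMode (-1) (weighted w β) γ n
  map_add' w w' := (hasPointwiseSum_normalMode_weighted β γ _ n).unique
    (((hasPointwiseSum_normalMode_weighted β γ w n).add
      (hasPointwiseSum_normalMode_weighted β γ w' n)).congr fun _ => (add_smul _ _ _).symm)
  map_smul' r w := (hasPointwiseSum_normalMode_weighted β γ _ n).unique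
    (((hasPointwiseSum_normalMode_weighted β γ w n).smul r).congr fun _ => (mul_smul _ _ _).symm)

variable {β γ : VertexOperator ℂ V}

theorem hasPointwiseSum_bilin (β γ : VertexOperator ℂ V) (w : ℤ → ℂ) (n : ℤ) :
    HasPointwiseSum (fun p => w p • wick (-1) β γ p (n - 1 - p)) (bilin β γ n w) :=
  hasPointwiseSum_normalMode_weighted β γ w n

/-- The normal orderings on the two sides differ only for `-d ≤ p < 0`, where `u` vanishes. -/
theorem normalMode_eq_bilin {A B : VertexOperator ℂ V} {u v : ℤ → ℂ} {d e : ℤ} (hd : 0 ≤ d)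
    (hA : ∀ p, ncoeff A (p + d) = u p • ncoeff β p)
    (hB : ∀ q, ncoeff B q = v q • ncoeff γ (q - e)) (hu : ∀ p < 0, -d ≤ p → u p = 0) (n : ℤ) :
    normalMode (-1) A B n = bilin β γ (n - d - e) fun p => u p * v (n - 1 - p - d) := by
  refine ((hasPointwiseSum_normalMode (-1) A B n).shift d).unique
    ((hasPointwiseSum_bilin β γ _ _).congr fun p => ?_)
  have hq : n - 1 - p - d - e = n - d - e - 1 - p := by ring
  rw [← sub_sub, ← hq]
  rcases lt_or_ge p (-d) with hp | hp
  · rw [wick_of_neg _ _ _ (by lia), wick_of_neg _ _ _ (by lia), hA, hB, smul_mul_smul_comm]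
  rcases lt_or_ge p 0 with hp0 | hp0
  · rw [wick_of_nonneg _ _ _ (p := p + d) (by lia), hA, hu p hp0 hp, zero_mul, zero_smul,
      zero_smul, mul_zero, smul_zero]
  · rw [wick_of_nonneg _ _ _ (by lia), wick_of_nonneg _ _ _ (by lia), hA, hB, smul_mul_smul_comm,
      smul_comm, mul_comm (v _)]

theorem lie_mul_eq_anticommutator {R : Type*} [Ring R] (x y z : R) :
    ⁅x * y, z⁆ = x * (y * z + z * y) - (x * z + z * x) * y := by
  rw [Ring.lie_def]
  noncomm_ring

namespace IsFermionPair

variable (H : IsFermionPair β γ)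

include H

theorem swap : IsFermionPair γ β :=
  ⟨H.gamma_gamma, H.beta_beta, fun m n => by rw [add_comm, H.beta_gamma, add_comm n m]⟩

theorem wick_eq (p q : ℤ) :
    wick (-1) β γ p q = ncoeff β p * ncoeff γ q - if 0 ≤ p ∧ p + q + 1 = 0 then 1 else 0 := by
  rcases lt_or_ge p 0 with hp | hp
  · rw [wick_of_neg _ _ _ hp, if_neg (by lia), sub_zero]
  · simp only [wick_of_nonneg _ _ _ hp, hp, true_and, ← H.beta_gamma p q]
    simp

theorem wick_swap (p q : ℤ) : wick (-1) β γ p q = -wick (-1) γ β q p := by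
  rw [H.wick_eq, H.swap.wick_eq, neg_sub, eq_sub_iff_add_eq, sub_add_eq_add_sub, H.beta_gamma]
  by_cases h : p + q + 1 = 0
  · rcases lt_or_ge p 0 with hp | hp
    · rw [if_pos h, if_neg (by lia), if_pos (by lia), sub_zero]
    · rw [if_pos h, if_pos (by lia), if_neg (by lia), sub_self]
  · rw [if_neg h, if_neg (by lia), if_neg (by lia), sub_zero]

theorem bilin_swap (w : ℤ → ℂ) (n : ℤ) :
    bilin γ β n w = -bilin β γ n fun p => w (n - 1 - p) := by
  have h := ((hasPointwiseSum_bilin γ β w n).comp_equiv (Equiv.subLeft (n - 1))).smul (-1)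
  rw [neg_one_smul] at h
  refine neg_eq_iff_eq_neg.1 (h.unique ((hasPointwiseSum_bilin β γ _ n).congr fun p => ?_))
  rw [H.wick_swap, smul_neg, Equiv.subLeft_apply, sub_sub_cancel, neg_one_smul]

theorem lie_bilin_beta (w : ℤ → ℂ) (n k : ℤ) :
    ⁅ncoeff β k, bilin β γ n w⁆ = -(w (n + k) • ncoeff β (n + k)) := by
  refine ((hasPointwiseSum_bilin β γ w n).lie_left _).unique
    ((hasPointwiseSum_single (n + k) _).congr fun p => ?_)
  rw [lie_smul, H.wick_eq, lie_sub, ← lie_skew, lie_mul_eq_anticommutator, H.beta_beta,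
    H.swap.beta_gamma]
  by_cases h : p = n + k
  · rw [if_pos h, if_pos (by lia), h]
    simp [apply_ite, Ring.lie_def]
  · rw [if_neg h, if_neg (by lia)]
    simp [Ring.lie_def]

theorem bilin_lie_beta (w : ℤ → ℂ) (n k : ℤ) :
    ⁅bilin β γ n w, ncoeff β k⁆ = w (n + k) • ncoeff β (n + k) := by
  rw [← lie_skew, H.lie_bilin_beta, neg_neg]

theorem bilin_lie_gamma (w : ℤ → ℂ) (n k : ℤ) :
    ⁅bilin β γ n w, ncoeff γ k⁆ = -(w (-k - 1) • ncoeff γ (n + k)) := by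
  rw [H.swap.bilin_swap, neg_lie, H.swap.bilin_lie_beta, show n - 1 - (n + k) = -k - 1 by ring]

end IsFermionPair

end FermionPair

section Current

variable {V : Type*} [AddCommGroup V] [Module ℂ V] {β γ : VertexOperator ℂ V}

theorem ncoeff_nopOdd (β γ : VertexOperator ℂ V) (n : ℤ) :
    ncoeff (nopOdd β γ) n = bilin β γ n 1 := by
  rw [ncoeff_normalOrder]
  exact (hasPointwiseSum_normalMode (-1) β γ n).unique
    ((hasPointwiseSum_bilin β γ _ n).congr fun p => one_smul ℂ _)

namespace IsFermionPair

variable (H : IsFermionPair β γ)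

include H

theorem nopOdd_swap : nopOdd γ β = -nopOdd β γ :=
  field_ext fun n => by
    rw [map_neg, Pi.neg_apply, ncoeff_nopOdd, ncoeff_nopOdd, H.bilin_swap]
    rfl

theorem lie_current_beta (m k : ℤ) : ⁅ncoeff (nopOdd β γ) m, ncoeff β k⁆ = ncoeff β (m + k) := by
  rw [ncoeff_nopOdd, H.bilin_lie_beta, Pi.one_apply, one_smul]

theorem lie_current_gamma (m k : ℤ) :
    ⁅ncoeff (nopOdd β γ) m, ncoeff γ k⁆ = -ncoeff γ (m + k) := by
  rw [ncoeff_nopOdd, H.bilin_lie_gamma, Pi.one_apply, one_smul]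

theorem lie_current_wick (m p q : ℤ) : ⁅ncoeff (nopOdd β γ) m, wick (-1) β γ p q⁆ =
    wick (-1) β γ (p + m) q - wick (-1) β γ p (m + q) +
      (if m + p + q + 1 = 0 then (if -m ≤ p then 1 else 0) - (if 0 ≤ p then 1 else 0) else 0 : ℂ) •
        1 := by
  have hone : ⁅ncoeff (nopOdd β γ) m, (1 : Module.End ℂ V)⁆ = 0 := by simp [Ring.lie_def]
  rw [H.wick_eq, H.wick_eq, H.wick_eq, lie_sub, apply_ite (⁅ncoeff (nopOdd β γ) m, ·⁆), hone,
    lie_zero, ite_self, sub_zero, lie_mul, H.lie_current_beta, H.lie_current_gamma, mul_neg,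
    ← sub_eq_add_neg, add_comm p m, show p + (m + q) + 1 = m + p + q + 1 by ring]
  simp only [← neg_le_iff_add_nonneg' (a := m) (b := p)]
  split_ifs <;> first | module | lia

/-- The central term is the total weight `∑ w(p)` over the interval between `-m` and `0`. -/
theorem lie_current_bilin {g w : ℤ → ℂ} (hg : ∀ k, g (k + 1) = g k + w k) (m n : ℤ) :
    ⁅ncoeff (nopOdd β γ) m, bilin β γ n w⁆ =
      bilin β γ (n + m) (fun p => w (p - m) - w p) +
        (g 0 - g (-m)) • ncoeff identityField (n + (m - 1)) := by
  have hw : (fun p => w (p - m) - w p) = (fun p => w (p - m)) - w := rfl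
  have hshift := (hasPointwiseSum_bilin β γ (fun p => w (p - m)) (n + m)).shift m
  have hsub := hshift.sub (hasPointwiseSum_bilin β γ w (n + m))
  have hstep := (hasPointwiseSum_step (V := V) hg (-m)).smul (if n + m = 0 then 1 else 0)
  have hone : ncoeff (identityField : VertexOperator ℂ V) (n + (m - 1)) =
      if n + m = 0 then 1 else 0 := by
    rw [ncoeff_identityField]
    exact if_congr (by lia) rfl rfl
  rw [smul_comm, ite_smul, one_smul, zero_smul, ← hone] at hstep
  rw [hw, map_sub]
  refine ((hasPointwiseSum_bilin β γ w n).lie_left _).unique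
    ((hsub.add hstep).congr fun p => ?_)
  rw [lie_smul, H.lie_current_wick, show m + p + (n - 1 - p) + 1 = n + m by ring,
    show n + m - 1 - (p + m) = n - 1 - p by ring, show m + (n - 1 - p) = n + m - 1 - p by ring,
    add_sub_cancel_right]
  split_ifs <;> module

end IsFermionPair

end Current

section StressTensor

variable {V : Type*} [AddCommGroup V] [Module ℂ V] {β γ : VertexOperator ℂ V}

/-- The fermionic stress tensor `:∂β γ:`. -/
def fermionStress (β γ : VertexOperator ℂ V) : VertexOperator ℂ V :=
  nopOdd (fieldDeriv β) γ

/-- The fermionic field `½(:∂²β γ: - :∂β ∂γ:)` of weight three. -/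
def fermionCubic (β γ : VertexOperator ℂ V) : VertexOperator ℂ V :=
  (1 / 2 : ℂ) • (nopOdd (fieldDeriv (fieldDeriv β)) γ - nopOdd (fieldDeriv β) (fieldDeriv γ))

theorem ncoeff_fieldDeriv_add_one (A : VertexOperator ℂ V) (p : ℤ) :
    ncoeff (fieldDeriv A) (p + 1) = (-(p + 1) : ℂ) • ncoeff A p := by
  rw [ncoeff_fieldDeriv, add_sub_cancel_right]
  push_cast
  rfl

theorem ncoeff_fieldDeriv_fieldDeriv_add_two (A : VertexOperator ℂ V) (p : ℤ) :
    ncoeff (fieldDeriv (fieldDeriv A)) (p + 2) = ((p + 1) * (p + 2) : ℂ) • ncoeff A p := by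
  rw [ncoeff_fieldDeriv, show p + 2 - 1 = p + 1 by ring, ncoeff_fieldDeriv_add_one, smul_smul]
  congr 1
  push_cast
  ring

theorem ncoeff_fermionStress (β γ : VertexOperator ℂ V) (n : ℤ) :
    ncoeff (fermionStress β γ) n = bilin β γ (n - 1) fun p => -(p + 1) := by
  rw [fermionStress, ncoeff_normalOrder, normalMode_eq_bilin (γ := γ) (v := 1) (e := 0) zero_le_one
    (ncoeff_fieldDeriv_add_one β) (fun q => by simp)
    (fun p hp hp' => by rw [show p = -1 by lia]; simp), sub_zero]
  simp only [Pi.one_apply, mul_one]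

theorem ncoeff_fermionCubic (β γ : VertexOperator ℂ V) (n : ℤ) :
    ncoeff (fermionCubic β γ) n =
      bilin β γ (n - 2) fun p => (p + 1) * (2 * p + 4 - n) / 2 := by
  rw [fermionCubic, map_smul, Pi.smul_apply, map_sub, Pi.sub_apply, ncoeff_normalOrder,
    ncoeff_normalOrder, normalMode_eq_bilin (γ := γ) (v := 1) (e := 0) zero_le_two
      (ncoeff_fieldDeriv_fieldDeriv_add_two β) (fun q => by simp)
      (fun p hp hp' => by rcases show p = -1 ∨ p = -2 by lia with rfl | rfl <;> simp),
    normalMode_eq_bilin zero_le_one (ncoeff_fieldDeriv_add_one β) (ncoeff_fieldDeriv γ)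
      (fun p hp hp' => by rw [show p = -1 by lia]; simp), sub_zero, sub_sub, one_add_one_eq_two,
    ← map_sub, ← map_smul]
  congr 1
  funext p
  simp only [Pi.smul_apply, Pi.sub_apply, Pi.one_apply, smul_eq_mul]
  push_cast
  ring

namespace IsFermionPair

theorem hasWeight_beta (H : IsFermionPair β γ) : HasWeight (ncoeff (fermionStress β γ) 1) β 0 :=
  fun n => by
    rw [ncoeff_fermionStress, H.bilin_lie_beta, sub_self, zero_add]
    congr 1
    ring

theorem hasWeight_gamma (H : IsFermionPair β γ) : HasWeight (ncoeff (fermionStress β γ) 1) γ 1 :=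
  fun n => by
    rw [ncoeff_fermionStress, H.bilin_lie_gamma, sub_self, zero_add, ← neg_smul]
    congr 1
    push_cast
    ring

theorem hasWeight_current (H : IsFermionPair β γ) :
    HasWeight (ncoeff (fermionStress β γ) 1) (nopOdd β γ) 1 := by
  have h := H.hasWeight_beta.normalOrder (-1) H.hasWeight_gamma
  rwa [zero_add] at h

theorem hasWeight_fermionStress (H : IsFermionPair β γ) :
    HasWeight (ncoeff (fermionStress β γ) 1) (fermionStress β γ) 2 := by
  have h := H.hasWeight_beta.fieldDeriv.normalOrder (-1) H.hasWeight_gamma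
  rwa [zero_add, one_add_one_eq_two] at h

theorem hasWeight_fermionCubic (H : IsFermionPair β γ) :
    HasWeight (ncoeff (fermionStress β γ) 1) (fermionCubic β γ) 3 := by
  have h := H.hasWeight_beta.fieldDeriv.fieldDeriv.normalOrder (-1) H.hasWeight_gamma
  have h' := H.hasWeight_beta.fieldDeriv.normalOrder (-1) H.hasWeight_gamma.fieldDeriv
  rw [zero_add, one_add_one_eq_two, two_add_one_eq_three] at h
  rw [zero_add, one_add_one_eq_two, add_comm 1, two_add_one_eq_three] at h'
  exact (h.sub h').smul _

theorem isHeisenberg_current (H : IsFermionPair β γ) : IsHeisenberg (nopOdd β γ) := fun m n => by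
  have hw : (fun p : ℤ => (1 : ℤ → ℂ) (p - m) - (1 : ℤ → ℂ) p) = 0 := by
    funext p
    simp
  rw [ncoeff_nopOdd β γ n, H.lie_current_bilin (g := fun k => k) (fun k => by simp), hw, map_zero,
    zero_add, ncoeff_identityField, smul_ite, smul_zero]
  exact if_congr (by lia) (by simp) rfl

theorem lie_current_fermionStress (H : IsFermionPair β γ) (m n : ℤ) :
    ⁅ncoeff (nopOdd β γ) m, ncoeff (fermionStress β γ) n⁆ =
      (m : ℂ) • ncoeff (nopOdd β γ) (n + (m - 1)) +
        (m * (m - 1) / 2 : ℂ) • ncoeff identityField (n + (m - 2)) := by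
  have hw : (fun p : ℤ => (-((p - m : ℤ) + 1) : ℂ) - -(p + 1)) = (m : ℂ) • 1 := by
    funext p
    simp
  rw [ncoeff_fermionStress, H.lie_current_bilin (g := fun k => -(k * (k + 1)) / 2)
    (fun k => by push_cast; ring), hw, map_smul, ncoeff_nopOdd β γ (n + (m - 1)),
    show n - 1 + m = n + (m - 1) by ring, show n - 1 + (m - 1) = n + (m - 2) by ring]
  congr 2
  push_cast
  ring

theorem lie_current_fermionCubic (H : IsFermionPair β γ) (m n : ℤ) :
    ⁅ncoeff (nopOdd β γ) m, ncoeff (fermionCubic β γ) n⁆ =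
      (2 * m : ℂ) • ncoeff (fermionStress β γ) (n + (m - 1)) +
      (m * (n + 2 * m - 2) / 2 : ℂ) • ncoeff (nopOdd β γ) (n + (m - 2)) +
      (m * (m - 1) * (m - 2) / 12 : ℂ) • ncoeff identityField (n + (m - 3)) := by
  have hw : (fun p : ℤ => (((p - m : ℤ) + 1) * (2 * (p - m : ℤ) + 4 - n) / 2 : ℂ) -
      (p + 1) * (2 * p + 4 - n) / 2) =
      (2 * m : ℂ) • (fun p : ℤ => (-(p + 1) : ℂ)) + (m * (n + 2 * m - 2) / 2 : ℂ) • 1 := by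
    funext p
    simp only [Pi.add_apply, Pi.smul_apply, Pi.one_apply, smul_eq_mul]
    push_cast
    ring
  rw [ncoeff_fermionCubic, H.lie_current_bilin
    (g := fun k => k * (k + 1) * (k + 2) / 3 - n * k * (k + 1) / 4) (fun k => by push_cast; ring),
    hw, map_add, map_smul, map_smul, ncoeff_nopOdd β γ (n + (m - 2)), ncoeff_fermionStress,
    show n + (m - 1) - 1 = n - 2 + m by ring, show n + (m - 2) = n - 2 + m by ring,
    show n - 2 + (m - 1) = n + (m - 3) by ring]
  congr 1
  refine smul_ncoeff_identityField_congr fun hn => ?_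
  rw [show n = 2 - m by lia]
  push_cast
  ring

end IsFermionPair

end StressTensor

section ChargedVacuum

variable {V : Type*} [AddCommGroup V] [Module ℂ V]

/-- `v` is a vacuum vector of charge `l` of the fermionic fields `β`, `γ`: a nonzero vector
annihilated by the modes `βₙ`, `n ≥ -l`, and `γₙ`, `n ≥ l`. -/
structure IsChargedVacuum (β γ : VertexOperator ℂ V) (l : ℤ) (v : V) : Prop where
  ne_zero : v ≠ 0
  beta_apply {n : ℤ} (hn : -l ≤ n) : ncoeff β n v = 0
  gamma_apply {n : ℤ} (hn : l ≤ n) : ncoeff γ n v = 0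

namespace IsChargedVacuum

variable {β γ : VertexOperator ℂ V} {l : ℤ} {v : V}

theorem swap (hv : IsChargedVacuum β γ l v) : IsChargedVacuum γ β (-l) v :=
  ⟨hv.ne_zero, fun hn => hv.gamma_apply (by lia), fun hn => hv.beta_apply (by lia)⟩

theorem gamma_beta_apply (hv : IsChargedVacuum β γ l v) (H : IsFermionPair β γ) :
    ncoeff γ l (ncoeff β (-l - 1) v) = v := by
  have h := LinearMap.congr_fun (H.beta_gamma (-l - 1) l) v
  rwa [LinearMap.add_apply, Module.End.mul_apply, Module.End.mul_apply, hv.gamma_apply le_rfl,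
    map_zero, zero_add, if_pos (by ring)] at h

theorem beta_apply_isChargedVacuum (hv : IsChargedVacuum β γ l v) (H : IsFermionPair β γ) :
    IsChargedVacuum β γ (l + 1) (ncoeff β (-l - 1) v) where
  ne_zero h := hv.ne_zero <| by rw [← hv.gamma_beta_apply H, h, map_zero]
  beta_apply {n} hn := by
    have h := LinearMap.congr_fun (H.beta_beta n (-l - 1)) v
    rw [LinearMap.add_apply, Module.End.mul_apply, Module.End.mul_apply] at h
    rcases eq_or_ne n (-l - 1) with rfl | hn'
    · have : IsAddTorsionFree V := .of_isTorsionFree ℂ V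
      exact self_eq_neg.1 (eq_neg_of_add_eq_zero_left h)
    · rwa [hv.beta_apply (n := n) (by lia), map_zero, add_zero] at h
  gamma_apply {n} hn := by
    have h := LinearMap.congr_fun (H.beta_gamma (-l - 1) n) v
    rwa [LinearMap.add_apply, Module.End.mul_apply, Module.End.mul_apply, hv.gamma_apply (by lia),
      map_zero, zero_add, if_neg (by lia)] at h

theorem bilin_apply_of_pos (hv : IsChargedVacuum β γ l v) (H : IsFermionPair β γ) {n : ℤ}
    (hn : 0 < n) (w : ℤ → ℂ) : bilin β γ n w v = 0 := by
  refine (hasPointwiseSum_bilin β γ w n).apply_eq_zero fun p => ?_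
  rw [LinearMap.smul_apply]
  rcases le_or_gt l (n - 1 - p) with hp | hp
  · rw [H.wick_eq, if_neg (by lia), sub_zero, Module.End.mul_apply, hv.gamma_apply hp, map_zero,
      smul_zero]
  · rw [H.wick_swap, H.swap.wick_eq, if_neg (by lia), sub_zero, LinearMap.neg_apply,
      Module.End.mul_apply, hv.beta_apply (by lia), map_zero, neg_zero, smul_zero]

theorem bilin_zero_apply (hv : IsChargedVacuum β γ l v) (H : IsFermionPair β γ) {g w : ℤ → ℂ}
    (hg : ∀ k, g (k + 1) = g k + w k) : bilin β γ 0 w v = (g 0 - g (-l)) • v := by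
  refine (hasPointwiseSum_bilin β γ w 0).apply_eq (hasPointwiseSum_step hg (-l)) fun p => ?_
  have hwick : ncoeff β p (ncoeff γ (-1 - p) v) = (if -l ≤ p then 1 else 0 : ℂ) • v := by
    rcases le_or_gt (-l) p with hp | hp
    · have h := LinearMap.congr_fun (H.beta_gamma p (-1 - p)) v
      rw [if_pos hp, one_smul]
      rwa [if_pos (by ring), LinearMap.add_apply, Module.End.mul_apply, Module.End.mul_apply,
        hv.beta_apply hp, map_zero, add_zero] at h
    · rw [hv.gamma_apply (by lia), map_zero, if_neg hp.not_ge, zero_smul]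
  have hite : (if 0 ≤ p ∧ p + (0 - 1 - p) + 1 = 0 then 1 else 0 : Module.End ℂ V) =
      (if 0 ≤ p then 1 else 0 : ℂ) • 1 := by
    rw [ite_smul, one_smul, zero_smul]
    exact if_congr (by lia) rfl rfl
  rw [mul_smul, LinearMap.smul_apply, LinearMap.smul_apply, H.wick_eq, hite, zero_sub,
    LinearMap.sub_apply, Module.End.mul_apply, hwick, sub_smul]
  rfl

theorem hasTopMode_current (hv : IsChargedVacuum β γ l v) (H : IsFermionPair β γ) :
    HasTopMode (nopOdd β γ) 0 l v where
  apply_top := by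
    rw [ncoeff_nopOdd, hv.bilin_zero_apply H (g := fun k => k) fun k => by simp]
    simp
  apply_of_lt hn := by rw [ncoeff_nopOdd, hv.bilin_apply_of_pos H hn]

theorem hasTopMode_fermionStress (hv : IsChargedVacuum β γ l v) (H : IsFermionPair β γ) :
    HasTopMode (fermionStress β γ) 1 (l * (l - 1) / 2) v where
  apply_top := by
    rw [ncoeff_fermionStress, sub_self,
      hv.bilin_zero_apply H (g := fun k => -(k * (k + 1)) / 2) fun k => by push_cast; ring]
    congr 1
    push_cast
    ring
  apply_of_lt hn := by rw [ncoeff_fermionStress, hv.bilin_apply_of_pos H (by lia)]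

theorem hasTopMode_fermionCubic (hv : IsChargedVacuum β γ l v) (H : IsFermionPair β γ) :
    HasTopMode (fermionCubic β γ) 2 (l * (l - 1) * (2 * l - 1) / 6) v where
  apply_top := by
    rw [ncoeff_fermionCubic, sub_self,
      hv.bilin_zero_apply H (g := fun k => k * (k + 1) * (2 * k + 1) / 6) fun k => by
        push_cast; ring]
    congr 1
    push_cast
    ring
  apply_of_lt hn := by rw [ncoeff_fermionCubic, hv.bilin_apply_of_pos H (by lia)]

end IsChargedVacuum

end ChargedVacuum

section FermionFock

variable {V : Type*} [AddCommGroup V] [Module ℂ V]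

/-- `V` is a Fock space of the fermionic fields `β`, `γ` with vacuum `Ω`: a cyclic vector
annihilated by all nonnegative modes. -/
structure IsFermionFock (β γ : VertexOperator ℂ V) (Ω : V) : Prop extends IsFermionPair β γ where
  vacuum : IsChargedVacuum β γ 0 Ω
  eq_top {S : Submodule ℂ V} (hΩ : Ω ∈ S) (hβ : ∀ n : ℤ, ∀ v ∈ S, ncoeff β n v ∈ S)
    (hγ : ∀ n : ℤ, ∀ v ∈ S, ncoeff γ n v ∈ S) : S = ⊤

variable {β γ : VertexOperator ℂ V} {Ω : V}

theorem IsFermionPair.normalMode_current_anticomm_beta (H : IsFermionPair β γ) (k : ℤ) :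
    normalMode 1 (nopOdd β γ) β 0 * ncoeff β k +
      ncoeff β k * normalMode 1 (nopOdd β γ) β 0 = 0 := by
  have hmode := hasPointwiseSum_normalMode 1 (nopOdd β γ) β 0
  have hanti (p q : ℤ) : ncoeff β p * ncoeff β q = -(ncoeff β q * ncoeff β p) :=
    eq_neg_of_add_eq_zero_left (H.beta_beta p q)
  have hsum : HasPointwiseSum (fun i => -(ncoeff β (i + k) * ncoeff β (-1 - i)))
      (normalMode 1 (nopOdd β γ) β 0 * ncoeff β k +
        ncoeff β k * normalMode 1 (nopOdd β γ) β 0) := by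
    refine ((hmode.mul_right (ncoeff β k)).add (hmode.mul_left (ncoeff β k))).congr fun i => ?_
    have hlie := H.lie_current_beta i k
    rw [Ring.lie_def] at hlie
    rw [zero_sub]
    rcases lt_or_ge i 0 with hi | hi
    · rw [wick_of_neg _ _ _ hi, mul_assoc, hanti _ k, ← hlie]
      noncomm_ring
    · rw [wick_of_nonneg _ _ _ hi, Units.val_one, Int.cast_one, one_smul, ← mul_assoc,
        hanti k, hanti (i + k), ← hlie]
      noncomm_ring
  have hneg := (hsum.comp_equiv (Equiv.subLeft (-1 - k))).smul (-1)
  have : IsAddTorsionFree (Module.End ℂ V) := .of_isTorsionFree ℂ _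
  refine self_eq_neg.1 ((hsum.unique (hneg.congr fun i => ?_)).trans (neg_one_smul ℂ _))
  rw [Equiv.subLeft_apply, neg_one_smul, neg_neg, hanti, show -1 - k - i + k = -1 - i by ring,
    show -1 - (-1 - k - i) = i + k by ring]

theorem IsFermionPair.normalMode_current_anticomm_gamma (H : IsFermionPair β γ) (k : ℤ) :
    normalMode 1 (nopOdd β γ) β 0 * ncoeff γ k +
      ncoeff γ k * normalMode 1 (nopOdd β γ) β 0 = 0 := by
  have hmode := hasPointwiseSum_normalMode 1 (nopOdd β γ) β 0
  have hsum : HasPointwiseSum (fun i => (if i = k then ncoeff (nopOdd β γ) k else 0) -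
      wick (-1) β γ (-1 - i) (k + i))
      (normalMode 1 (nopOdd β γ) β 0 * ncoeff γ k +
        ncoeff γ k * normalMode 1 (nopOdd β γ) β 0) := by
    refine ((hmode.mul_right (ncoeff γ k)).add (hmode.mul_left (ncoeff γ k))).congr fun i => ?_
    have hlie : ncoeff γ (k + i) = ncoeff γ k * ncoeff (nopOdd β γ) i -
        ncoeff (nopOdd β γ) i * ncoeff γ k := by
      rw [add_comm, ← neg_inj, ← H.lie_current_gamma, Ring.lie_def, neg_sub]
    have hanti := H.beta_gamma (-1 - i) k
    simp only [show -1 - i + k + 1 = 0 ↔ i = k by lia] at hanti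
    have hite : (if i = k then ncoeff (nopOdd β γ) k else 0) =
        (if i = k then 1 else 0) * ncoeff (nopOdd β γ) i := by
      rcases eq_or_ne i k with rfl | hik <;> simp [*]
    have hcomm : Commute (if i = k then 1 else 0) (ncoeff (nopOdd β γ) i) := by
      split_ifs <;> simp
    rw [zero_sub]
    rcases lt_or_ge i 0 with hi | hi
    · rw [wick_of_neg _ _ _ hi, wick_of_nonneg _ _ _ (by lia), hite, hcomm.eq, ← hanti, hlie,
        Units.val_neg, Units.val_one, Int.cast_neg, Int.cast_one, neg_one_smul]
      noncomm_ring
    · rw [wick_of_nonneg _ _ _ hi, wick_of_neg _ _ _ (by lia), hite, ← hanti, hlie, Units.val_one,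
        Int.cast_one, one_smul]
      noncomm_ring
  have hcurrent : HasPointwiseSum (fun i => wick (-1) β γ (-1 - i) (k + i))
      (ncoeff (nopOdd β γ) k) := by
    rw [ncoeff_normalOrder]
    refine ((hasPointwiseSum_normalMode (-1) β γ k).comp_equiv (Equiv.subLeft (-1))).congr
      fun i => ?_
    rw [Equiv.subLeft_apply, show k - 1 - (-1 - i) = k + i by ring]
  rw [hsum.unique ((hasPointwiseSum_single k _).sub hcurrent), sub_self]

namespace IsFermionFock

variable (H : IsFermionFock β γ Ω)

include H

theorem swap : IsFermionFock γ β Ω :=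
  ⟨H.toIsFermionPair.swap, H.vacuum.swap, fun hΩ hγ hβ => H.eq_top hΩ hβ hγ⟩

theorem eq_zero_of_anticomm {X : Module.End ℂ V}
    (hβ : ∀ k, X * ncoeff β k + ncoeff β k * X = 0)
    (hγ : ∀ k, X * ncoeff γ k + ncoeff γ k * X = 0) (hΩ : X Ω = 0) : X = 0 := by
  have hker {A : Module.End ℂ V} (hA : X * A + A * X = 0) (v : V) (hv : X v = 0) : X (A v) = 0 := by
    have h := LinearMap.congr_fun hA v
    rwa [LinearMap.add_apply, Module.End.mul_apply, Module.End.mul_apply, hv, map_zero,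
      add_zero] at h
  exact LinearMap.ker_eq_top.1 (H.eq_top hΩ (fun n => hker (hβ n)) fun n => hker (hγ n))

theorem normalMode_current_beta_zero : normalMode 1 (nopOdd β γ) β 0 = 0 := by
  refine H.eq_zero_of_anticomm H.normalMode_current_anticomm_beta
    H.normalMode_current_anticomm_gamma ?_
  have hJ := H.vacuum.hasTopMode_current H.toIsFermionPair
  refine (hasPointwiseSum_normalMode 1 (nopOdd β γ) β 0).apply_eq_zero fun p => ?_
  rcases lt_trichotomy p 0 with hp | rfl | hp
  · rw [wick_of_neg _ _ _ hp, Module.End.mul_apply, H.vacuum.beta_apply (by lia), map_zero]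
  · rw [wick_of_nonneg _ _ _ le_rfl, LinearMap.smul_apply, Module.End.mul_apply, hJ.apply_top,
      Int.cast_zero, zero_smul, map_zero, smul_zero]
  · rw [wick_of_nonneg _ _ _ hp.le, LinearMap.smul_apply, Module.End.mul_apply,
      hJ.apply_of_lt hp, map_zero, smul_zero]

theorem nopEven_current_beta : nopEven (nopOdd β γ) β = fieldDeriv β :=
  field_ext fun n => by
    have hlie := H.isHeisenberg_current.lie_nopEven (B := β) (C := β) (m := n) (r := 1) (d := n)
      (fun k => by rw [H.lie_current_beta, one_smul, add_comm]) 0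
    rw [ncoeff_normalOrder 1, H.normalMode_current_beta_zero, lie_zero, zero_add, zero_add,
      one_smul] at hlie
    rw [ncoeff_fieldDeriv, neg_smul]
    exact eq_neg_of_add_eq_zero_right hlie.symm

end IsFermionFock

end FermionFock

section CyclicSpan

variable {V : Type*} [AddCommGroup V] [Module ℂ V] {J A : VertexOperator ℂ V} {l : ℤ} {v : V}

/-- On `v` the relation `:JA: = ∂A` is a recursion, expressing `Aₙ v` in terms of the vectors
`J_p A_{n-p} v`, `p < 0`. -/
theorem ncoeff_mem_cyclicSpan_of_nopEven_eq_fieldDeriv (hv : HasTopMode J 0 l v)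
    (hA : nopEven J A = fieldDeriv A) (htop : ∀ n, -l ≤ n → ncoeff A n v = 0) (n : ℤ) :
    ncoeff A n v ∈ cyclicSpan J (ncoeff A (-l - 1) v) := by
  induction hk : (-l - n).toNat using Nat.strong_induction_on generalizing n with
  | _ k ih =>
    rcases lt_trichotomy n (-l - 1) with hn | rfl | hn
    · have hmode : normalMode 1 J A (n + 1) = (-(n + 1) : ℂ) • ncoeff A n := by
        rw [← ncoeff_normalOrder, show normalOrder 1 J A = _ from hA, ncoeff_fieldDeriv,
          add_sub_cancel_right, Int.cast_add, Int.cast_one]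
      have hsum := (hasPointwiseSum_normalMode 1 J A (n + 1)).sub
        (hasPointwiseSum_single 0 ((l : ℂ) • ncoeff A n))
      rw [hmode, ← sub_smul] at hsum
      have hne : (-(n + 1) - l : ℂ) ≠ 0 := by
        exact_mod_cast show -(n + 1) - l ≠ 0 by lia
      refine (Submodule.smul_mem_iff _ hne).1 (hsum.mem fun p => ?_)
      rw [LinearMap.sub_apply, add_sub_cancel_right]
      rcases lt_trichotomy p 0 with hp | rfl | hp
      · rw [wick_of_neg _ _ _ hp, if_neg hp.ne, LinearMap.zero_apply, sub_zero]
        exact ncoeff_mem_cyclicSpan p (ih _ (by lia) (n - p) rfl)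
      · rw [wick_of_nonneg _ _ _ le_rfl, if_pos rfl]
        simp [hv.apply_top]
      · rw [wick_of_nonneg _ _ _ hp.le, if_neg hp.ne']
        simp [hv.apply_of_lt hp]
    · exact self_mem_cyclicSpan _ _
    · rw [htop n (by lia)]
      exact Submodule.zero_mem _

theorem cyclicSpan_le_comap_of_nopEven_eq_fieldDeriv (hv : HasTopMode J 0 l v)
    (hA : nopEven J A = fieldDeriv A)
    (htop : ∀ n, -l ≤ n → ncoeff A n v = 0)
    (hlie : ∀ m n, ⁅ncoeff J m, ncoeff A n⁆ = ncoeff A (m + n)) (n : ℤ) :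
    cyclicSpan J v ≤ (cyclicSpan J (ncoeff A (-l - 1) v)).comap (ncoeff A n) := by
  have hle : cyclicSpan J v ≤ ⨅ k, (cyclicSpan J (ncoeff A (-l - 1) v)).comap (ncoeff A k) := by
    refine cyclicSpan_le ((Submodule.mem_iInf _).2
      (ncoeff_mem_cyclicSpan_of_nopEven_eq_fieldDeriv hv hA htop)) fun m u hu =>
        (Submodule.mem_iInf _).2 fun k => ?_
    rw [Submodule.mem_iInf] at hu
    have h := LinearMap.congr_fun (hlie m k) u
    rw [Ring.lie_def, LinearMap.sub_apply, Module.End.mul_apply, Module.End.mul_apply] at h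
    rw [Submodule.mem_comap, ← sub_sub_cancel (ncoeff J m (ncoeff A k u))
      (ncoeff A k (ncoeff J m u)), h]
    exact Submodule.sub_mem _ (ncoeff_mem_cyclicSpan m (hu k)) (hu (m + k))
  exact hle.trans (iInf_le _ n)

theorem cyclicSpan_neg (J : VertexOperator ℂ V) (v : V) : cyclicSpan (-J) v = cyclicSpan J v := by
  simp [cyclicSpan]

end CyclicSpan

section ChargeDecomposition

variable {V : Type*} [AddCommGroup V] [Module ℂ V] {β γ : VertexOperator ℂ V} {l : ℤ} {v : V}

theorem IsChargedVacuum.cyclicSpan_le_comap_beta (hv : IsChargedVacuum β γ l v)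
    (H : IsFermionPair β γ) (hβ : nopEven (nopOdd β γ) β = fieldDeriv β) (n : ℤ) :
    cyclicSpan (nopOdd β γ) v ≤
      (cyclicSpan (nopOdd β γ) (ncoeff β (-l - 1) v)).comap (ncoeff β n) :=
  cyclicSpan_le_comap_of_nopEven_eq_fieldDeriv (hv.hasTopMode_current H) hβ
    (fun _ hn => hv.beta_apply hn) H.lie_current_beta n

theorem IsChargedVacuum.cyclicSpan_le_comap_gamma (hv : IsChargedVacuum β γ l v)
    (H : IsFermionPair β γ) (hγ : nopEven (nopOdd γ β) γ = fieldDeriv γ) (n : ℤ) :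
    cyclicSpan (nopOdd β γ) v ≤
      (cyclicSpan (nopOdd β γ) (ncoeff γ (l - 1) v)).comap (ncoeff γ n) := by
  have h := hv.swap.cyclicSpan_le_comap_beta H.swap hγ n
  rwa [H.nopOdd_swap, cyclicSpan_neg, cyclicSpan_neg, neg_neg] at h

/-- The vector `A_{-k} ⋯ A_{-1} Ω`. -/
def fermiSea (A : VertexOperator ℂ V) (Ω : V) : ℕ → V
  | 0 => Ω
  | k + 1 => ncoeff A (-k - 1) (fermiSea A Ω k)

theorem IsChargedVacuum.fermiSea {Ω : V} (hΩ : IsChargedVacuum β γ 0 Ω) (H : IsFermionPair β γ)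
    (k : ℕ) : IsChargedVacuum β γ k (fermiSea β Ω k) := by
  induction k with
  | zero => exact hΩ
  | succ k ih => exact ih.beta_apply_isChargedVacuum H

/-- The vacuum vector of charge `l`, obtained from `Ω` by filling the first `|l|` modes of `β` or
of `γ` according to the sign of `l`. -/
def chargedVacuum (β γ : VertexOperator ℂ V) (Ω : V) : ℤ → V
  | .ofNat k => fermiSea β Ω k
  | .negSucc k => fermiSea γ Ω (k + 1)

theorem chargedVacuum_neg_natCast (β γ : VertexOperator ℂ V) (Ω : V) (k : ℕ) :
    chargedVacuum β γ Ω (-k) = fermiSea γ Ω k := by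
  cases k <;> rfl

namespace IsFermionFock

variable {Ω : V} (H : IsFermionFock β γ Ω)

include H

theorem isChargedVacuum_chargedVacuum :
    ∀ l : ℤ, IsChargedVacuum β γ l (chargedVacuum β γ Ω l)
  | .ofNat k => H.vacuum.fermiSea H.toIsFermionPair k
  | .negSucc k => (H.swap.vacuum.fermiSea H.swap.toIsFermionPair (k + 1)).swap

theorem beta_chargedVacuum (l : ℤ) :
    ncoeff β (-l - 1) (chargedVacuum β γ Ω l) = chargedVacuum β γ Ω (l + 1) := by
  obtain k | k := l
  · rfl
  · have h := (H.swap.vacuum.fermiSea H.swap.toIsFermionPair k).gamma_beta_apply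
      H.swap.toIsFermionPair
    rwa [show -Int.negSucc k - 1 = k by lia, show Int.negSucc k + 1 = -k by lia,
      chargedVacuum_neg_natCast]

theorem gamma_chargedVacuum (l : ℤ) :
    ncoeff γ (l - 1) (chargedVacuum β γ Ω l) = chargedVacuum β γ Ω (l - 1) := by
  have h := (H.isChargedVacuum_chargedVacuum (l - 1)).gamma_beta_apply H.toIsFermionPair
  rwa [H.beta_chargedVacuum, sub_add_cancel] at h

theorem iSup_cyclicSpan_chargedVacuum :
    ⨆ l, cyclicSpan (nopOdd β γ) (chargedVacuum β γ Ω l) = ⊤ := by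
  have hle {X : Module.End ℂ V} {σ : ℤ → ℤ}
      (h : ∀ l, cyclicSpan (nopOdd β γ) (chargedVacuum β γ Ω l) ≤
        (cyclicSpan (nopOdd β γ) (chargedVacuum β γ Ω (σ l))).comap X) :
      ⨆ l, cyclicSpan (nopOdd β γ) (chargedVacuum β γ Ω l) ≤
        (⨆ l, cyclicSpan (nopOdd β γ) (chargedVacuum β γ Ω l)).comap X :=
    iSup_le fun l => (h l).trans (Submodule.comap_mono (le_iSup_of_le (σ l) le_rfl))
  refine H.eq_top (Submodule.mem_iSup_of_mem 0 (self_mem_cyclicSpan _ Ω))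
    (fun n => hle (σ := (· + 1)) fun l => ?_) fun n => hle (σ := (· - 1)) fun l => ?_
  · rw [← H.beta_chargedVacuum]
    exact (H.isChargedVacuum_chargedVacuum l).cyclicSpan_le_comap_beta H.toIsFermionPair
      H.nopEven_current_beta n
  · rw [← H.gamma_chargedVacuum]
    exact (H.isChargedVacuum_chargedVacuum l).cyclicSpan_le_comap_gamma H.toIsFermionPair
      H.swap.nopEven_current_beta n

theorem cyclicSpan_chargedVacuum (l : ℤ) : cyclicSpan (nopOdd β γ) (chargedVacuum β γ Ω l) =
    Module.End.eigenspace (ncoeff (nopOdd β γ) 0) l := by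
  have hle (k : ℤ) : cyclicSpan (nopOdd β γ) (chargedVacuum β γ Ω k) ≤
      Module.End.eigenspace (ncoeff (nopOdd β γ) 0) k := by
    have hJ := (H.isChargedVacuum_chargedVacuum k).hasTopMode_current H.toIsFermionPair
    refine cyclicSpan_le (Module.End.mem_eigenspace_iff.2 hJ.apply_top) fun m u hu => ?_
    rw [Module.End.mem_eigenspace_iff] at hu ⊢
    have hlie := LinearMap.congr_fun (H.isHeisenberg_current 0 m) u
    rw [Int.cast_zero, zero_smul, ite_self, Ring.lie_def, LinearMap.sub_apply,
      Module.End.mul_apply, Module.End.mul_apply, hu, map_smul] at hlie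
    exact sub_eq_zero.1 hlie
  have hindep := (Module.End.eigenspaces_iSupIndep (ncoeff (nopOdd β γ) 0)).comp
    (Int.cast_injective (α := ℂ))
  exact congr_fun ((hindep.le_iff_eq_of_iSup_eq_top H.iSup_cyclicSpan_chargedVacuum).1 hle) l

theorem eq_zero_of_commute_current {D : VertexOperator ℂ V} {d : ℤ}
    (hcomm : ∀ m n : ℤ, ⁅ncoeff (nopOdd β γ) m, ncoeff D n⁆ = 0)
    (hweight : HasWeight (ncoeff (fermionStress β γ) 1) D (d + 1))
    (htop : ∀ l : ℤ, ncoeff D d (chargedVacuum β γ Ω l) = 0) : D = 0 := by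
  refine field_ext fun n => ?_
  rw [map_zero, Pi.zero_apply, ← LinearMap.ker_eq_top, eq_top_iff,
    ← H.iSup_cyclicSpan_chargedVacuum]
  have hcommute (m : ℤ) (u : V) :
      ncoeff (nopOdd β γ) m (ncoeff D n u) = ncoeff D n (ncoeff (nopOdd β γ) m u) :=
    sub_eq_zero.1 (LinearMap.congr_fun (hcomm m n) u)
  refine iSup_le fun l => cyclicSpan_le ?_ fun m u hu => ?_
  · have hv := H.isChargedVacuum_chargedVacuum l
    have hJ := hv.hasTopMode_current H.toIsFermionPair
    have hL := (hv.hasTopMode_fermionStress H.toIsFermionPair).apply_top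
    obtain ⟨r, hr⟩ := hJ.exists_eq_smul H.isHeisenberg_current hv.ne_zero
      (u := ncoeff D n (chargedVacuum β γ Ω l))
      (by rw [H.cyclicSpan_chargedVacuum, Module.End.mem_eigenspace_iff, hcommute, hJ.apply_top,
        map_smul])
      fun m hm => by rw [hcommute, hJ.apply_of_lt hm, map_zero]
    have hlie := LinearMap.congr_fun (hweight n) (chargedVacuum β γ Ω l)
    rw [Ring.lie_def, LinearMap.sub_apply, Module.End.mul_apply, Module.End.mul_apply, hL, map_smul,
      hr, map_smul, hL, smul_comm, sub_self, LinearMap.smul_apply, eq_comm, smul_eq_zero] at hlie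
    rw [LinearMap.mem_ker]
    rcases eq_or_ne n d with rfl | hn
    · exact htop l
    · refine hlie.resolve_left fun h => hn ?_
      exact_mod_cast show (n : ℂ) = d by linear_combination -h
  · rw [LinearMap.mem_ker] at hu ⊢
    rw [← hcommute, hu, map_zero]

theorem fermionStress_eq_bosonStress : fermionStress β γ = bosonStress (nopOdd β γ) := by
  refine sub_eq_zero.1 (H.eq_zero_of_commute_current (d := 1) (fun m n => ?_) ?_ fun l => ?_)
  · rw [map_sub, Pi.sub_apply, lie_sub, H.lie_current_fermionStress,
      H.isHeisenberg_current.lie_bosonStress, sub_self]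
  · have h := H.hasWeight_fermionStress.sub H.hasWeight_current.bosonStress
    rwa [Int.cast_one, one_add_one_eq_two]
  · have hv := H.isChargedVacuum_chargedVacuum l
    rw [map_sub, Pi.sub_apply, LinearMap.sub_apply,
      (hv.hasTopMode_fermionStress H.toIsFermionPair).apply_top,
      (hv.hasTopMode_current H.toIsFermionPair).bosonStress.apply_top, sub_self]

theorem fermionCubic_eq_bosonCubic : fermionCubic β γ = bosonCubic (nopOdd β γ) := by
  refine sub_eq_zero.1 (H.eq_zero_of_commute_current (d := 2) (fun m n => ?_) ?_ fun l => ?_)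
  · rw [map_sub, Pi.sub_apply, lie_sub, H.lie_current_fermionCubic,
      H.isHeisenberg_current.lie_bosonCubic, H.fermionStress_eq_bosonStress, sub_self]
  · have h := H.hasWeight_fermionCubic.sub H.hasWeight_current.bosonCubic
    rwa [Int.cast_ofNat, two_add_one_eq_three]
  · have hv := H.isChargedVacuum_chargedVacuum l
    rw [map_sub, Pi.sub_apply, LinearMap.sub_apply,
      (hv.hasTopMode_fermionCubic H.toIsFermionPair).apply_top,
      (hv.hasTopMode_current H.toIsFermionPair).bosonCubic.apply_top, sub_self]

end IsFermionFock

end ChargeDecomposition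

section FockSpace

theorem create_anticomm (i k : ℕ ⊕ ℕ) : create i * create k + create k * create i = 0 := by
  refine LinearMap.ext fun v => ?_
  change ExteriorAlgebra.ι ℂ _ * (ExteriorAlgebra.ι ℂ _ * v) +
    ExteriorAlgebra.ι ℂ _ * (ExteriorAlgebra.ι ℂ _ * v) = 0
  rw [← mul_assoc, ← mul_assoc, ← add_mul, ExteriorAlgebra.ι_add_mul_swap, zero_mul]

theorem annihilate_anticomm (i k : ℕ ⊕ ℕ) :
    annihilate i * annihilate k + annihilate k * annihilate i = 0 :=
  LinearMap.ext fun v => add_eq_zero_iff_eq_neg.2 <|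
    CliffordAlgebra.contractLeft_comm (Q := (0 : QuadraticForm ℂ ((ℕ ⊕ ℕ) →₀ ℂ))) _ _ v

theorem annihilate_create_anticomm (i k : ℕ ⊕ ℕ) :
    annihilate i * create k + create k * annihilate i = if i = k then 1 else 0 := by
  refine LinearMap.ext fun v => ?_
  have h := CliffordAlgebra.contractLeft_ι_mul (Q := (0 : QuadraticForm ℂ ((ℕ ⊕ ℕ) →₀ ℂ)))
    (d := Finsupp.lapply i) (Finsupp.single k 1) v
  refine (add_eq_of_eq_sub h).trans ?_
  rcases eq_or_ne i k with rfl | hik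
  · simp
  · simp [hik]

theorem annihilate_one (i : ℕ ⊕ ℕ) : annihilate i 1 = 0 :=
  CliffordAlgebra.contractLeft_one (Q := (0 : QuadraticForm ℂ ((ℕ ⊕ ℕ) →₀ ℂ))) _

theorem submodule_fock_eq_top {S : Submodule ℂ Fock} (h1 : 1 ∈ S)
    (hcreate : ∀ i, ∀ v ∈ S, create i v ∈ S) : S = ⊤ := by
  refine Submodule.eq_top_iff'.2 fun v => ?_
  induction v using CliffordAlgebra.left_induction with
  | algebraMap r =>
    rw [Algebra.algebraMap_eq_smul_one]
    exact S.smul_mem r h1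
  | add x y hx hy => exact S.add_mem hx hy
  | ι_mul x m hx =>
    induction m using Finsupp.induction_linear with
    | zero => simp
    | add f g hf hg =>
      rw [map_add, add_mul]
      exact S.add_mem hf hg
    | single i r =>
      rw [← Finsupp.smul_single_one, map_smul, smul_mul_assoc]
      exact S.smul_mem r (hcreate i x hx)

theorem ncoeff_b_natCast (k : ℕ) : ncoeff b k = annihilate (Sum.inr k) :=
  ncoeff_ofModes _ _ _

theorem ncoeff_b_negSucc : ∀ k : ℕ, ncoeff b (Int.negSucc k) = create (Sum.inl k)
  | 0 => ncoeff_ofModes _ _ _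
  | _ + 1 => ncoeff_ofModes _ _ _

theorem ncoeff_c_natCast (k : ℕ) : ncoeff c k = annihilate (Sum.inl k) :=
  ncoeff_ofModes _ _ _

theorem ncoeff_c_negSucc (k : ℕ) : ncoeff c (Int.negSucc k) = create (Sum.inr k) :=
  ncoeff_ofModes _ _ _

theorem isFermionPair_b_c : IsFermionPair b c where
  beta_beta m n := by
    obtain m | m := m <;> obtain n | n := n <;>
      simp only [Int.ofNat_eq_natCast, ncoeff_b_natCast, ncoeff_b_negSucc]
    · exact annihilate_anticomm _ _
    · rw [annihilate_create_anticomm, if_neg Sum.inr_ne_inl]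
    · rw [add_comm, annihilate_create_anticomm, if_neg Sum.inr_ne_inl]
    · exact create_anticomm _ _
  gamma_gamma m n := by
    obtain m | m := m <;> obtain n | n := n <;>
      simp only [Int.ofNat_eq_natCast, ncoeff_c_natCast, ncoeff_c_negSucc]
    · exact annihilate_anticomm _ _
    · rw [annihilate_create_anticomm, if_neg Sum.inl_ne_inr]
    · rw [add_comm, annihilate_create_anticomm, if_neg Sum.inl_ne_inr]
    · exact create_anticomm _ _
  beta_gamma m n := by
    obtain m | m := m <;> obtain n | n := n <;>
      simp only [Int.ofNat_eq_natCast, ncoeff_b_natCast, ncoeff_b_negSucc, ncoeff_c_natCast,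
        ncoeff_c_negSucc]
    · rw [if_neg (by lia), annihilate_anticomm]
    · rw [annihilate_create_anticomm]
      exact if_congr (by rw [Sum.inr.injEq]; lia) rfl rfl
    · rw [add_comm, annihilate_create_anticomm]
      exact if_congr (by rw [Sum.inl.injEq]; lia) rfl rfl
    · rw [if_neg (by lia), create_anticomm]

theorem isFermionFock_b_c : IsFermionFock b c 1 where
  toIsFermionPair := isFermionPair_b_c
  vacuum :=
    { ne_zero := one_ne_zero
      beta_apply := fun {n} hn => by
        lift n to ℕ using hn
        rw [ncoeff_b_natCast, annihilate_one]
      gamma_apply := fun {n} hn => by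
        lift n to ℕ using hn
        rw [ncoeff_c_natCast, annihilate_one] }
  eq_top h1 hb hc := submodule_fock_eq_top h1 fun i v hv => by
    obtain k | k := i
    · rw [← ncoeff_b_negSucc]
      exact hb _ v hv
    · rw [← ncoeff_c_negSucc]
      exact hc _ v hv

theorem exists_isBosonFermionCorrespondence (l : ℤ) :
    ∃ Φ : Heis ≃ₗ[ℂ] charge l, IsBosonFermionCorrespondence l Φ := by
  have hv := isFermionFock_b_c.isChargedVacuum_chargedVacuum l
  obtain ⟨ψ, hone, hψ⟩ := (hv.hasTopMode_current isFermionPair_b_c).exists_intertwines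
    isFermionPair_b_c.isHeisenberg_current
  have hrange : LinearMap.range ψ = charge l := by
    rw [hψ.range_eq_cyclicSpan, hone, isFermionFock_b_c.cyclicSpan_chargedVacuum]
    rfl
  exact ⟨.ofInjective ψ (hψ.injective (hone ▸ hv.ne_zero)) ≪≫ₗ .ofEq _ _ hrange, hψ⟩

end FockSpace

end BosonFermion

end

open VertexOperator BosonFermion in
theorem mainTheorem6 :
    (T = (1 / 2 : ℂ) • (nopEven j j + fieldDeriv j) ∧
      Wtilde = (1 / 12 : ℂ) • ((4 : ℂ) • nopEven j (nopEven j j) +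
        (6 : ℂ) • nopEven j (fieldDeriv j) + fieldDeriv (fieldDeriv j))) ∧
    ∀ l : ℤ,
      (∃ Φ : Heis ≃ₗ[ℂ] charge l, IsBosonFermionCorrespondence l Φ) ∧
      ∀ Φ : Heis ≃ₗ[ℂ] charge l, IsBosonFermionCorrespondence l Φ →
        ∀ (n : ℤ) (x : Heis),
          ncoeff T n (Φ x : Fock) =
            (Φ (ncoeff ((1 / 2 : ℂ) • (nopEven (jH l) (jH l) + fieldDeriv (jH l))) n x) : Fock) ∧
          ncoeff Wtilde n (Φ x : Fock) =
            (Φ (ncoeff ((1 / 12 : ℂ) • ((4 : ℂ) • nopEven (jH l) (nopEven (jH l) (jH l)) +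
              (6 : ℂ) • nopEven (jH l) (fieldDeriv (jH l)) + fieldDeriv (fieldDeriv (jH l)))) n x) : Fock) := by
  have hT : T = bosonStress j := isFermionFock_b_c.fermionStress_eq_bosonStress
  have hW : Wtilde = bosonCubic j := isFermionFock_b_c.fermionCubic_eq_bosonCubic
  refine ⟨⟨hT, hW⟩, fun l => ⟨exists_isBosonFermionCorrespondence l, fun Φ hΦ n x => ?_⟩⟩
  have hφ : Intertwines ((charge l).subtype ∘ₗ Φ.toLinearMap) (jH l) j := hΦ
  rw [hT, hW]
  exact ⟨(hφ.bosonStress n x).symm, (hφ.bosonCubic n x).symm⟩
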